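/- Let $n\ge 2$, let $\Omega\subset\mathbb R^2$ be open, and let $A\in\mathcal C^1(\Omega,\mathbb C^{n\times n})$ be such that, for every $\xi\in\Omega$, the singular values $\sigma_1(A(\xi))\ge\dots\ge\sigma_n(A(\xi))\ge 0$ are distinct. Let $\xi_0\in\Omega$ be the only point of $\Omega$ where $A$ loses rank, i.e. for $\xi\in\Omega$, $\operatorname{rank}A(\xi)<n$ if and only if $\xi=\xi_0$. For $\eta=(\xi,\varepsilon)\in\Omega\times\mathbb R\subset\mathbb R^3$ put $$M(\eta)=\begin{bmatrix}\varepsilon I & A(\xi)\\ A(\xi)^* & -\varepsilon I\end{bmatrix}\in\mathbb C^{2n\times 2n}.$$ Then $\xi_0$ is a generic point of loss of rank for $A$ if and only if $\eta_0=(\xi_0,0)$ is a generic point of coalescence for the eigenvalues of the Hermitian function $M$ on $\Omega\times\mathbb R$. Here the following terms are used. A point $v$ is a *regular zero* of a map $F$ between open subsets of Euclidean spaces of equal dimension if $F(v)=0$ and the derivative of $F$ at $v$ exists and is invertible. The point $\xi_0$ is a *generic point of loss of rank* for $A$ if it is a regular zero of $\xi\mapsto(\operatorname{Re}\det A(\xi),\operatorname{Im}\det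 A(\xi))\in\mathbb R^2$. Let $B\in\mathcal C^1(D,\mathbb C^{m\times m})$ be Hermitian on an open set $D\subset\mathbb R^3$, with eigenvalues $\lambda_1(\eta)\ge\dots\ge\lambda_m(\eta)$. A point $\eta_0\in D$ is a *generic point of coalescence* for the eigenvalues of $B$ if there is an index $h$ with $1\le h<m$ such that, for $1\le j<m$ and $\eta\in D$, $\lambda_j(\eta)=\lambda_{j+1}(\eta)$ if and only if $j=h$ and $\eta=\eta_0$, and moreover: (i) if $m=2$ and $B=\begin{bmatrix}a&b+ic\\b-ic&d\end{bmatrix}$ with $a,b,c,d$ real valued, then $\eta_0$ is a regular zero of $F=(a-d,\,b,\,c)$; (ii) if $m>2$, then there is a $\mathcal C^1$ block Schur decomposition $B=U\begin{bmatrix}P&0\\0&\Lambda\end{bmatrix}U^*$ on some product $R\subset D$ of three intervals with $\eta_0$ in its interior, where $U$ is unitary, $P$ is a $2\times 2$ matrix function with eigenvalues $\lambda_h,\lambda_{h+1}$, and $\Lambda=\operatorname{diag}(\lambda_1,\dots,\lambda_{h-1},\lambda_{h+2},\dots,\lambda_m)$; and, for every such decomposition, $\eta_0$ is a regular zero of the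 map $F$ of (i) formed from $P$. -/

import Mathlib

open Matrix

noncomputable section

/-- The two-dimensional parameter space `ℝ²`, with points `ξ = (x, y)`. -/
abbrev Plane : Type := ℝ × ℝ

/-- The three-dimensional parameter space `ℝ³ = ℝ² × ℝ`, with points `((x, y), z)`. -/
abbrev Space : Type := (ℝ × ℝ) × ℝ

/-- `A ∈ C¹(Ω, ℂ^{m × n})`: every entry is continuously differentiable on `Ω`
(as a function of real variables). -/
def MatrixC1On {E : Type*} [NormedAddCommGroup E] [NormedSpace ℝ E] {ι κ : Type*}
    (Ω : Set E) (A : E → Matrix ι κ ℂ) : Prop :=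
  ∀ i j, ContDiffOn ℝ 1 (fun ξ => A ξ i j) Ω

/-- `v` is a regular zero of `F`: `F v = 0` and the derivative of `F` at `v` exists and is
invertible. -/
def IsRegularZero {E G : Type*} [NormedAddCommGroup E] [NormedSpace ℝ E]
    [NormedAddCommGroup G] [NormedSpace ℝ G] (F : E → G) (v : E) : Prop :=
  F v = 0 ∧ ∃ F' : E ≃L[ℝ] G, HasFDerivAt F (F' : E →L[ℝ] G) v

/-- The `n` singular values of `A ∈ ℂ^{n × n}`, listed in decreasing order. -/
def singVal {n : ℕ} (A : Matrix (Fin n) (Fin n) ℂ) (j : Fin n) : ℝ :=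
  (Matrix.toEuclideanLin A).singularValues j

/-- `ξ₀` is a generic point of loss of rank for `A`: it is a regular zero of
`ξ ↦ (Re det A(ξ), Im det A(ξ))`. -/
def IsGenericLossOfRank {n : ℕ} (A : Plane → Matrix (Fin n) (Fin n) ℂ) (ξ₀ : Plane) : Prop :=
  IsRegularZero (fun ξ => (((A ξ).det.re, (A ξ).det.im) : ℝ × ℝ)) ξ₀

/-- The eigenvalues `λ_0 ≥ ⋯ ≥ λ_{m-1}` of a Hermitian matrix, in decreasing order. -/
def eig {m : ℕ} {B : Matrix (Fin m) (Fin m) ℂ} (hB : B.IsHermitian) (j : Fin m) : ℝ :=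
  hB.eigenvalues₀ (Fin.cast (Fintype.card_fin m).symm j)

/-- For a Hermitian `P = [[a, b + i c], [b - i c, d]]`, the vector `(a - d, b, c)`. -/
def coalescenceMap (P : Matrix (Fin 2) (Fin 2) ℂ) : ℝ × ℝ × ℝ :=
  ((P 0 0).re - (P 1 1).re, (P 0 1).re, (P 0 1).im)

/-- A product of three intervals of `ℝ` (of any kind). -/
def IsPluriRectangle (R : Set Space) : Prop :=
  ∃ I J K : Set ℝ, I.OrdConnected ∧ J.OrdConnected ∧ K.OrdConnected ∧ R = (I ×ˢ J) ×ˢ K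

/-- `λ_j(ξ) = λ_{j+1}(ξ)` with `ξ ∈ Ω` if and only if `j = h` and `ξ = ξ₀` (indices from `0`). -/
def CoalesceOnlyAt {m : ℕ} (Ω : Set Space) (A : Space → Matrix (Fin m) (Fin m) ℂ)
    (hA : ∀ ξ ∈ Ω, (A ξ).IsHermitian) (h : ℕ) (ξ₀ : Space) : Prop :=
  ∀ (j : ℕ) (hj : j + 1 < m) (ξ : Space) (hξ : ξ ∈ Ω),
    eig (hA ξ hξ) ⟨j, Nat.lt_of_succ_lt hj⟩ = eig (hA ξ hξ) ⟨j + 1, hj⟩ ↔ j = h ∧ ξ = ξ₀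

/-- A `C¹` block Schur decomposition `A = U [[P, 0], [0, Λ]] U*` on a pluri-rectangle `R ⊆ Ω`
having `ξ₀` in its interior: `U` is unitary, `P` is `2 × 2` with eigenvalues `λ_h, λ_{h+1}`, and
`Λ` is the diagonal matrix of the remaining eigenvalues in decreasing order. -/
structure IsBlockSchur {m : ℕ} (Ω : Set Space) (A : Space → Matrix (Fin m) (Fin m) ℂ)
    (hA : ∀ ξ ∈ Ω, (A ξ).IsHermitian) (h : ℕ) (hh : h + 1 < m) (ξ₀ : Space) (R : Set Space)
    (U : Space → Matrix (Fin m) (Fin 2 ⊕ {i : Fin m // (i : ℕ) ≠ h ∧ (i : ℕ) ≠ h + 1}) ℂ)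
    (P : Space → Matrix (Fin 2) (Fin 2) ℂ)
    (L : Space → Matrix {i : Fin m // (i : ℕ) ≠ h ∧ (i : ℕ) ≠ h + 1}
      {i : Fin m // (i : ℕ) ≠ h ∧ (i : ℕ) ≠ h + 1} ℂ) : Prop where
  rectangle : IsPluriRectangle R
  subset : R ⊆ Ω
  mem_interior : ξ₀ ∈ interior R
  smooth_U : MatrixC1On R U
  smooth_P : MatrixC1On R P
  smooth_L : MatrixC1On R L
  unitary_left : ∀ ξ ∈ R, (U ξ)ᴴ * U ξ = 1
  unitary_right : ∀ ξ ∈ R, U ξ * (U ξ)ᴴ = 1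
  decomp : ∀ ξ ∈ R, A ξ = U ξ * Matrix.fromBlocks (P ξ) 0 0 (L ξ) * (U ξ)ᴴ
  eig_L : ∀ (ξ : Space) (hξ : ξ ∈ R),
    L ξ = Matrix.diagonal fun i => ((eig (hA ξ (subset hξ)) i.1 : ℝ) : ℂ)
  eig_P : ∀ (ξ : Space) (hξ : ξ ∈ R),
    (P ξ).charpoly.roots =
      {((eig (hA ξ (subset hξ)) ⟨h, Nat.lt_of_succ_lt hh⟩ : ℝ) : ℂ),
        ((eig (hA ξ (subset hξ)) ⟨h + 1, hh⟩ : ℝ) : ℂ)}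

/-- `ξ₀ ∈ Ω` is a generic point of coalescence for the eigenvalues of the Hermitian function `A`
on `Ω ⊆ ℝ³`: exactly one pair of consecutive eigenvalues coalesces, and only at `ξ₀`; and
* if `m = 2`, `ξ₀` is a regular zero of `(a - d, b, c)` for `A = [[a, b + i c], [b - i c, d]]`;
* if `m > 2`, `ξ₀` is a regular zero of that map for the `2 × 2` block `P` of a `C¹` block Schur
  decomposition of `A` near `ξ₀`. Such a decomposition has to exist, and the condition is imposed
  on all of them, so that it does not hinge on a choice. -/
def IsGenericCoalescence {m : ℕ} (Ω : Set Space) (A : Space → Matrix (Fin m) (Fin m) ℂ)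
    (hA : ∀ ξ ∈ Ω, (A ξ).IsHermitian) (ξ₀ : Space) : Prop :=
  ξ₀ ∈ Ω ∧ ∃ (h : ℕ) (hh : h + 1 < m), CoalesceOnlyAt Ω A hA h ξ₀ ∧
    (∀ hm : m = 2, IsRegularZero
      (fun ξ => coalescenceMap ((A ξ).reindex (finCongr hm) (finCongr hm))) ξ₀) ∧
    (2 < m →
      (∃ R U P L, IsBlockSchur Ω A hA h hh ξ₀ R U P L) ∧
      ∀ R U P L, IsBlockSchur Ω A hA h hh ξ₀ R U P L →
        IsRegularZero (fun ξ => coalescenceMap (P ξ)) ξ₀)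

/-- `M(ξ, ε) = [[ε I, A(ξ)], [A(ξ)*, -ε I]]`, a `2n × 2n` matrix. -/
def hermitianM {n : ℕ} (A : Plane → Matrix (Fin n) (Fin n) ℂ) (η : Space) :
    Matrix (Fin (n + n)) (Fin (n + n)) ℂ :=
  (Matrix.fromBlocks ((η.2 : ℂ) • (1 : Matrix (Fin n) (Fin n) ℂ)) (A η.1)
    (A η.1)ᴴ (-((η.2 : ℂ) • (1 : Matrix (Fin n) (Fin n) ℂ)))).reindex
      finSumFinEquiv finSumFinEquiv

theorem hermitianM_isHermitian {n : ℕ} (A : Plane → Matrix (Fin n) (Fin n) ℂ) (η : Space) :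
    (hermitianM A η).IsHermitian := by
  unfold hermitianM
  rw [Matrix.reindex_apply]
  apply Matrix.IsHermitian.submatrix
  apply Matrix.IsHermitian.fromBlocks
  · simp [Matrix.IsHermitian, Matrix.conjTranspose_smul]
  · simp
  · simp [Matrix.IsHermitian, Matrix.conjTranspose_smul]

end

/-!
At `ξ₀` the kernels of `A` and `A*` are lines, spanned by unit vectors `v` and `u`. By Jacobi's
formula the derivative of `det A` at `ξ₀` in a direction `w` is a nonzero multiple of
`u* A'(w) v`, so the loss of rank is generic iff `u* A'(w) v ≠ 0` for all `w ≠ 0`.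

The eigenvalues of `M(ξ, ε)` are `± √(ε² + σ_j(A(ξ))²)`, so consecutive ones coalesce only in the
middle, at `η₀`, where the kernel of `M` has the orthonormal frame `K` with columns `(u, 0)` and
`(0, v)`. For any block Schur decomposition near a point where one pair of eigenvalues coalesces,
the Hellmann–Feynman argument shows that the derivative of the `2 × 2` block at that point is, up
to a unitary change of basis, the compression of `M'` to the coalescing eigenspace; and the
coalescence is generic iff this compression is a scalar matrix in no direction but `0`. Here the
compression in direction `(w, e)` is `[[e, u* A'(w) v], [conj (u* A'(w) v), -e]]`, which is scalar
iff `e = 0` and `u* A'(w) v = 0`.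

The decomposition itself exists because a simple eigenvalue and a unit eigenvector for it are `C¹`
by the implicit function theorem, and the frame of simple eigenvectors is completed by
Gram–Schmidt.
-/

open Topology Filter

section MatrixCalculus

variable {E : Type*} [NormedAddCommGroup E] [NormedSpace ℝ E] {ι κ l : Type*} {x : E}

/-- Every entry of the matrix function `A` is continuously differentiable near `x`; the pointwise
form of `MatrixC1On`. -/
def MatrixC1At (A : E → Matrix ι κ ℂ) (x : E) : Prop :=
  ∀ i j, ContDiffAt ℝ 1 (fun y => A y i j) x

/-- The derivative of the matrix function `A` at `x` in the direction `v`, taken entrywise so that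
no norm on matrices has to be chosen. -/
noncomputable def matrixFDeriv (A : E → Matrix ι κ ℂ) (x v : E) : Matrix ι κ ℂ :=
  Matrix.of fun i j => fderiv ℝ (fun y => A y i j) x v

theorem MatrixC1On.matrixC1At {R : Set E} {A : E → Matrix ι κ ℂ} (h : MatrixC1On R A)
    (hx : R ∈ 𝓝 x) : MatrixC1At A x :=
  fun i j => (h i j).contDiffAt hx

theorem MatrixC1At.eventually [Finite ι] [Finite κ] {A : E → Matrix ι κ ℂ}
    (hA : MatrixC1At A x) : ∀ᶠ y in 𝓝 x, MatrixC1At A y := by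
  simp only [MatrixC1At, eventually_all]
  exact fun i j => (hA i j).eventually (by simp)

theorem matrixFDeriv_congr {A B : E → Matrix ι κ ℂ} (h : A =ᶠ[𝓝 x] B) (v : E) :
    matrixFDeriv A x v = matrixFDeriv B x v := by
  ext i j
  have hij : (fun y => A y i j) =ᶠ[𝓝 x] fun y => B y i j := h.mono fun y hy => by
    simp only [hy]
  simp only [matrixFDeriv, of_apply, hij.fderiv_eq]

theorem matrixFDeriv_const (A : Matrix ι κ ℂ) (v : E) :
    matrixFDeriv (fun _ : E => A) x v = 0 := by
  ext i j
  simp [matrixFDeriv]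

namespace MatrixC1At

variable {A : E → Matrix ι κ ℂ}

theorem differentiableAt (hA : MatrixC1At A x) (i : ι) (j : κ) :
    DifferentiableAt ℝ (fun y => A y i j) x :=
  (hA i j).differentiableAt one_ne_zero

theorem continuousAt (hA : MatrixC1At A x) : ContinuousAt A x :=
  continuousAt_pi.2 fun i => continuousAt_pi.2 fun j => (hA i j).continuousAt

theorem const (A : Matrix ι κ ℂ) : MatrixC1At (fun _ : E => A) x :=
  fun _ _ => contDiffAt_const

theorem sub {B : E → Matrix ι κ ℂ} (hA : MatrixC1At A x) (hB : MatrixC1At B x) :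
    MatrixC1At (fun y => A y - B y) x :=
  fun i j => (hA i j).sub (hB i j)

theorem mul [Fintype κ] {B : E → Matrix κ l ℂ} (hA : MatrixC1At A x) (hB : MatrixC1At B x) :
    MatrixC1At (fun y => A y * B y) x := by
  intro i j
  simp only [Matrix.mul_apply]
  exact ContDiffAt.sum fun k _ => (hA i k).mul (hB k j)

theorem conjTranspose (hA : MatrixC1At A x) : MatrixC1At (fun y => (A y)ᴴ) x :=
  fun i j => Complex.conjCLE.contDiff.contDiffAt.comp x (hA j i)

theorem submatrix {ι' κ' : Type*} (hA : MatrixC1At A x) (f : ι' → ι) (g : κ' → κ) :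
    MatrixC1At (fun y => (A y).submatrix f g) x :=
  fun i j => hA (f i) (g j)

theorem toCols₁ {κ' : Type*} {U : E → Matrix ι (κ ⊕ κ') ℂ} (hU : MatrixC1At U x) :
    MatrixC1At (fun y => (U y).toCols₁) x :=
  hU.submatrix id Sum.inl

theorem fromCols {κ' : Type*} {B : E → Matrix ι κ' ℂ} (hA : MatrixC1At A x)
    (hB : MatrixC1At B x) : MatrixC1At (fun y => Matrix.fromCols (A y) (B y)) x := by
  rintro i (j | j)
  exacts [hA i j, hB i j]

theorem diagonal [DecidableEq ι] {d : E → ι → ℂ} (hd : ∀ i, ContDiffAt ℝ 1 (fun y => d y i) x) :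
    MatrixC1At (fun y => Matrix.diagonal (d y)) x := by
  intro i j
  obtain rfl | hij := eq_or_ne i j
  · simpa using hd i
  · simpa [Matrix.diagonal_apply_ne _ hij] using contDiffAt_const

theorem det [Fintype ι] [DecidableEq ι] {A : E → Matrix ι ι ℂ} (hA : MatrixC1At A x) :
    ContDiffAt ℝ 1 (fun y => (A y).det) x := by
  simp only [Matrix.det_apply']
  exact ContDiffAt.sum fun σ _ => contDiffAt_const.mul (contDiffAt_prod fun i _ => hA _ _)

theorem adjugate [Fintype ι] [DecidableEq ι] {A : E → Matrix ι ι ℂ} (hA : MatrixC1At A x) :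
    MatrixC1At (fun y => (A y).adjugate) x := by
  intro i j
  simp only [Matrix.adjugate_apply]
  refine MatrixC1At.det fun a b => ?_
  simp only [Matrix.updateRow_apply]
  split_ifs
  exacts [contDiffAt_const, hA a b]

theorem comp {F : Type*} [NormedAddCommGroup F] [NormedSpace ℝ F] {f : F → E} {y : F}
    (hA : MatrixC1At A (f y)) (hf : ContDiffAt ℝ 1 f y) : MatrixC1At (fun z => A (f z)) y :=
  fun i j => (hA i j).comp y hf

theorem matrixFDeriv_mul [Fintype κ] {B : E → Matrix κ l ℂ} (hA : MatrixC1At A x)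
    (hB : MatrixC1At B x) (v : E) : matrixFDeriv (fun y => A y * B y) x v =
      matrixFDeriv A x v * B x + A x * matrixFDeriv B x v := by
  ext i j
  have h : HasFDerivAt (fun y => ∑ k, A y i k * B y k j) _ x := HasFDerivAt.fun_sum fun k _ =>
    (hA.differentiableAt i k).hasFDerivAt.mul (hB.differentiableAt k j).hasFDerivAt
  simp only [matrixFDeriv, of_apply, Matrix.mul_apply, Matrix.add_apply, ← Finset.sum_add_distrib]
  rw [h.fderiv, _root_.sum_apply]
  refine Finset.sum_congr rfl fun k _ => ?_
  simp [mul_comm, add_comm]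

theorem matrixFDeriv_conjTranspose (hA : MatrixC1At A x) (v : E) :
    matrixFDeriv (fun y => (A y)ᴴ) x v = (matrixFDeriv A x v)ᴴ := by
  ext i j
  have h : HasFDerivAt (fun y => (A y)ᴴ i j) _ x :=
    (Complex.conjCLE : ℂ →L[ℝ] ℂ).hasFDerivAt.comp x (hA.differentiableAt j i).hasFDerivAt
  simp only [matrixFDeriv, of_apply, h.fderiv]
  rfl

theorem fderiv_det_smul_one [Fintype ι] [DecidableEq ι] {A : E → Matrix ι ι ℂ}
    (hA : MatrixC1At A x) (v : E) :
    (fderiv ℝ (fun y => (A y).det) x v) • (1 : Matrix ι ι ℂ) =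
      matrixFDeriv A x v * (A x).adjugate +
        A x * matrixFDeriv (fun y => (A y).adjugate) x v := by
  rw [← hA.matrixFDeriv_mul hA.adjugate]
  ext i j
  simp only [matrixFDeriv, of_apply, mul_adjugate, Matrix.smul_apply, smul_eq_mul]
  have hdet := (hA.det.differentiableAt one_ne_zero).hasFDerivAt.mul_const
    ((1 : Matrix ι ι ℂ) i j)
  simp [hdet.fderiv, mul_comm]

theorem adjugate_ne_zero [Fintype ι] [DecidableEq ι] {A : E → Matrix ι ι ℂ}
    (hA : MatrixC1At A x) (hdet : (A x).det = 0) {v : E}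
    (hder : fderiv ℝ (fun y => (A y).det) x v ≠ 0) : (A x).adjugate ≠ 0 := by
  intro hadj
  have h := congrArg Matrix.det (hA.fderiv_det_smul_one v)
  rw [hadj, Matrix.mul_zero, zero_add, det_mul, hdet, zero_mul, det_smul, det_one, mul_one] at h
  exact pow_ne_zero _ hder h

-- The Hellmann–Feynman formula for a whole eigenspace: the variation of the frame `W` drops out.
theorem matrixFDeriv_compression [Fintype ι] [DecidableEq κ] {B : E → Matrix ι ι ℂ}
    {W : E → Matrix ι κ ℂ} (hB : MatrixC1At B x) (hW : MatrixC1At W x) (hBx : (B x).IsHermitian)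
    (hWW : ∀ᶠ y in 𝓝 x, (W y)ᴴ * W y = 1) {μ : ℝ} (hμ : B x * W x = (μ : ℂ) • W x) (v : E) :
    matrixFDeriv (fun y => (W y)ᴴ * B y * W y) x v = (W x)ᴴ * matrixFDeriv B x v * W x := by
  have hμ' : (W x)ᴴ * B x = (μ : ℂ) • (W x)ᴴ := by
    simpa [hBx.eq] using congrArg Matrix.conjTranspose hμ
  have hdW : (matrixFDeriv W x v)ᴴ * W x + (W x)ᴴ * matrixFDeriv W x v = 0 := by
    rw [← hW.matrixFDeriv_conjTranspose, ← hW.conjTranspose.matrixFDeriv_mul hW,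
      matrixFDeriv_congr hWW, matrixFDeriv_const]
  rw [(hW.conjTranspose.mul hB).matrixFDeriv_mul hW, hW.conjTranspose.matrixFDeriv_mul hB,
    hW.matrixFDeriv_conjTranspose, Matrix.add_mul, Matrix.mul_assoc _ (B x), hμ, hμ',
    Matrix.mul_smul, Matrix.smul_mul, add_right_comm, ← smul_add, hdW, smul_zero, zero_add]

end MatrixC1At

end MatrixCalculus

section Eigenvalues

variable {m : ℕ} {B : Matrix (Fin m) (Fin m) ℂ}

theorem eig_antitone (hB : B.IsHermitian) : Antitone (eig hB) :=
  fun i j hij => hB.eigenvalues₀_antitone (by simpa using hij)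

theorem charpoly_eq_prod_eig (hB : B.IsHermitian) :
    B.charpoly = ∏ i, (Polynomial.X - Polynomial.C (eig hB i : ℂ)) := by
  rw [hB.charpoly_eq]
  refine Fintype.prod_equiv ((Fintype.equivOfCardEq (Fintype.card_fin _)).symm.trans
    (finCongr (Fintype.card_fin m))) _ _ fun i => ?_
  simp [eig, IsHermitian.eigenvalues]

theorem eig_eq_of_charpoly_eq_prod (hB : B.IsHermitian) {d : Fin m → ℝ} (hd : Antitone d)
    (hc : B.charpoly = ∏ i, (Polynomial.X - Polynomial.C (d i : ℂ))) : eig hB = d := by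
  have hroots : B.charpoly.roots.map RCLike.re = (List.ofFn d : Multiset ℝ) := by
    rw [hc, Polynomial.roots_prod _ _ (Finset.prod_ne_zero_iff.2
      fun i _ => Polynomial.X_sub_C_ne_zero _)]
    simp [← Fin.univ_val_map]
  have hsorted : (B.charpoly.roots.map RCLike.re).sort (· ≥ ·) = List.ofFn d := by
    rw [hroots, Multiset.coe_sort]
    apply List.mergeSort_of_pairwise
    simpa only [decide_eq_true_eq, ← List.sortedGE_iff_pairwise] using hd.sortedGE_ofFn
  have heig : List.ofFn (eig hB) = List.ofFn d := by
    rw [← hsorted, hB.sort_roots_charpoly_eq_eigenvalues₀]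
    exact List.ext_getElem (by simp) fun i _ _ => by simp [eig]
  exact List.ofFn_injective heig

theorem eval_charpoly_eig (hB : B.IsHermitian) (j : Fin m) :
    B.charpoly.eval (eig hB j : ℂ) = 0 := by
  rw [charpoly_eq_prod_eig hB, Polynomial.eval_prod]
  exact Finset.prod_eq_zero (Finset.mem_univ j) (by simp)

theorem eval_derivative_charpoly_eig (hB : B.IsHermitian) (j : Fin m) :
    B.charpoly.derivative.eval (eig hB j : ℂ) =
      ((∏ i ∈ Finset.univ.erase j, (eig hB j - eig hB i) : ℝ) : ℂ) := by
  have hnodal : B.charpoly = Lagrange.nodal Finset.univ fun i => (eig hB i : ℂ) :=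
    charpoly_eq_prod_eig hB
  rw [hnodal, Lagrange.eval_nodal_derivative_eval_node_eq
    (v := fun i => (eig hB i : ℂ)) (Finset.mem_univ j), Lagrange.eval_nodal]
  push_cast
  rfl

theorem spectrum_eq_range_eig (hB : B.IsHermitian) : spectrum ℝ B = Set.range (eig hB) := by
  rw [hB.spectrum_real_eq_range_eigenvalues]
  exact (((Fintype.equivOfCardEq (Fintype.card_fin _)).symm.trans
    (finCongr (Fintype.card_fin m))).surjective.range_comp (eig hB))

theorem eventually_eig_mem {E : Type*} [TopologicalSpace E] {x : E}
    {P : E → Matrix (Fin m) (Fin m) ℂ} (hP : ContinuousAt P x) (hPx : (P x).IsHermitian)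
    {s : Set ℝ} (hs : IsOpen s) (h : ∀ i, eig hPx i ∈ s) :
    ∀ᶠ y in 𝓝 x, ∀ (hPy : (P y).IsHermitian) i, eig hPy i ∈ s := by
  let : NormedRing (Matrix (Fin m) (Fin m) ℂ) := Matrix.linftyOpNormedRing
  let : NormedAlgebra ℝ (Matrix (Fin m) (Fin m) ℂ) := Matrix.linftyOpNormedAlgebra
  have hsub : spectrum ℝ (P x) ⊆ s := by
    rw [spectrum_eq_range_eig hPx]
    exact Set.range_subset_iff.2 h
  have hev := hP.eventually
    ((upperHemicontinuous_spectrum ℝ (Matrix (Fin m) (Fin m) ℂ)).forall_isOpen (P x) s hs hsub)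
  filter_upwards [hev] with y hy hPy i
  exact hy (spectrum_eq_range_eig hPy ▸ Set.mem_range_self i)

theorem eq_smul_one_of_eig_eq {B : Matrix (Fin m) (Fin m) ℂ} (hB : B.IsHermitian) {μ : ℝ}
    (h : ∀ i, eig hB i = μ) : B = (μ : ℂ) • 1 := by
  have heig : ∀ i, hB.eigenvalues i = μ := fun i =>
    h (Fin.cast (Fintype.card_fin m) ((Fintype.equivOfCardEq (Fintype.card_fin _)).symm i))
  have hdiag : diagonal (RCLike.ofReal ∘ hB.eigenvalues) =
      (μ : ℂ) • (1 : Matrix (Fin m) (Fin m) ℂ) := by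
    simp [Function.comp_def, heig, smul_one_eq_diagonal]
  rw [hB.spectral_theorem, hdiag, map_smul, map_one]

theorem adjugate_scalar_sub_ne_zero {ι : Type*} [Fintype ι] [DecidableEq ι] {H : Matrix ι ι ℂ}
    {μ : ℝ} (h0 : H.charpoly.eval (μ : ℂ) = 0) (h1 : H.charpoly.derivative.eval (μ : ℂ) ≠ 0) :
    (scalar ι (μ : ℂ) - H).adjugate ≠ 0 := by
  have hA : MatrixC1At (fun t : ℝ => scalar ι (t : ℂ) - H) μ :=
    (MatrixC1At.diagonal fun _ => Complex.ofRealCLM.contDiff.contDiffAt).sub (.const H)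
  have hder : HasDerivAt (fun t : ℝ => (scalar ι (t : ℂ) - H).det)
      (H.charpoly.derivative.eval (μ : ℂ)) μ := by
    simpa only [eval_charpoly] using (H.charpoly.hasDerivAt (μ : ℂ)).comp_ofReal
  refine hA.adjugate_ne_zero (v := 1) (by rw [← eval_charpoly, h0]) ?_
  rwa [fderiv_apply_one_eq_deriv, hder.deriv]

end Eigenvalues

section EigenFrames

variable {E : Type*} [NormedAddCommGroup E] [NormedSpace ℝ E] {ι κ : Type*} {x : E} {m : ℕ}

theorem exists_implicit_root [CompleteSpace E] {f : E × ℝ → ℝ} {μ d : ℝ}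
    (hf : ContDiffAt ℝ 1 f (x, μ)) (h0 : f (x, μ) = 0) (hd : HasDerivAt (fun t => f (x, t)) d μ)
    (hd0 : d ≠ 0) : ∃ φ : E → ℝ, ContDiffAt ℝ 1 φ x ∧ φ x = μ ∧ ∀ᶠ y in 𝓝 x, f (y, φ y) = 0 := by
  have hinv : (fderiv ℝ f (x, μ) ∘L .inr ℝ E ℝ).IsInvertible := by
    refine ⟨ContinuousLinearEquiv.unitsEquivAut ℝ (Units.mk0 d hd0), ?_⟩
    ext
    have hline : HasDerivAt (fun t : ℝ => (x, t)) ((0 : E), (1 : ℝ)) μ :=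
      (hasDerivAt_const μ x).prodMk (hasDerivAt_id μ)
    simpa using hd.unique
      ((hf.differentiableAt one_ne_zero).hasFDerivAt.comp_hasDerivAt μ hline)
  refine ⟨hf.implicitFunction one_ne_zero hinv, hf.contDiffAt_implicitFunction one_ne_zero hinv,
    hf.implicitFunction_apply_self one_ne_zero hinv, ?_⟩
  simpa [h0] using hf.eventually_apply_implicitFunction one_ne_zero hinv

theorem im_det_eq_zero_of_isHermitian [Fintype ι] [DecidableEq ι] {H : Matrix ι ι ℂ}
    (hH : H.IsHermitian) : H.det.im = 0 := by
  rw [← Complex.conj_eq_iff_im, starRingEnd_apply, ← det_conjTranspose, hH.eq]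

theorem MatrixC1At.scalar_sub [Fintype ι] [DecidableEq ι] {H : E → Matrix ι ι ℂ}
    {φ : E → ℝ} (hφ : ContDiffAt ℝ 1 φ x) (hH : MatrixC1At H x) :
    MatrixC1At (fun y => scalar ι (φ y : ℂ) - H y) x :=
  (MatrixC1At.diagonal (d := fun y _ => (φ y : ℂ)) fun _ =>
    Complex.ofRealCLM.contDiff.contDiffAt.comp x hφ).sub hH

theorem exists_contDiffAt_eigenvalue [CompleteSpace E] {H : E → Matrix (Fin m) (Fin m) ℂ}
    (hH : MatrixC1At H x) (hherm : ∀ᶠ y in 𝓝 x, (H y).IsHermitian) (hHx : (H x).IsHermitian)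
    {j : Fin m} (hj : ∀ i ≠ j, eig hHx i ≠ eig hHx j) :
    ∃ φ : E → ℝ, ContDiffAt ℝ 1 φ x ∧ φ x = eig hHx j ∧
      ∀ᶠ y in 𝓝 x, (H y).charpoly.eval (φ y : ℂ) = 0 := by
  let f : E × ℝ → ℝ := fun p => (scalar (Fin m) (p.2 : ℂ) - H p.1).det.re
  have hf : ContDiffAt ℝ 1 f (x, eig hHx j) :=
    Complex.reCLM.contDiff.contDiffAt.comp _
      (MatrixC1At.scalar_sub contDiffAt_snd (hH.comp (f := Prod.fst) contDiffAt_fst)).det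
  have hd : HasDerivAt (fun t : ℝ => f (x, t))
      (∏ i ∈ Finset.univ.erase j, (eig hHx j - eig hHx i)) (eig hHx j) := by
    have h := ((H x).charpoly.hasDerivAt (eig hHx j : ℂ)).real_of_complex
    rw [eval_derivative_charpoly_eig, Complex.ofReal_re] at h
    simpa only [f, eval_charpoly] using h
  obtain ⟨φ, hφ, hφx, hroot⟩ := exists_implicit_root hf
    (by simp only [f, ← eval_charpoly, eval_charpoly_eig, Complex.zero_re]) hd
    (Finset.prod_ne_zero_iff.2 fun i hi => sub_ne_zero.2 (hj i (Finset.ne_of_mem_erase hi)).symm)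
  refine ⟨φ, hφ, hφx, ?_⟩
  filter_upwards [hroot, hherm] with y hy hHy
  rw [eval_charpoly]
  refine Complex.ext hy (im_det_eq_zero_of_isHermitian (IsHermitian.sub ?_ hHy))
  simp [Matrix.IsHermitian, diagonal_conjTranspose, Pi.star_def]

theorem star_dotProduct_inv_norm_smul_self [Fintype ι] {w : ι → ℂ} (hw : w ≠ 0) :
    star (((‖WithLp.toLp 2 w‖⁻¹ : ℝ) : ℂ) • w) ⬝ᵥ (((‖WithLp.toLp 2 w‖⁻¹ : ℝ) : ℂ) • w) = 1 := by
  have hne : ‖WithLp.toLp 2 w‖ ≠ 0 := by simpa using hw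
  rw [dotProduct_comm, ← EuclideanSpace.inner_toLp_toLp, WithLp.toLp_smul,
    inner_self_eq_norm_sq_to_K, norm_smul]
  simp [hne]

theorem exists_contDiffAt_normalization [Fintype ι] {w : E → ι → ℂ} (hw : ContDiffAt ℝ 1 w x)
    (hwx : w x ≠ 0) : ∃ c : E → ℂ, ContDiffAt ℝ 1 c x ∧
      ∀ᶠ y in 𝓝 x, star (c y • w y) ⬝ᵥ (c y • w y) = 1 := by
  have hL : ContDiffAt ℝ 1 (fun y => WithLp.toLp 2 (w y)) x :=
    (PiLp.contDiff_toLp (p := 2)).contDiffAt.comp x hw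
  have hLx : WithLp.toLp 2 (w x) ≠ 0 := by simpa using hwx
  have hN : ContDiffAt ℝ 1 (fun y => ‖WithLp.toLp 2 (w y)‖) x := hL.norm ℂ hLx
  refine ⟨fun y => ((‖WithLp.toLp 2 (w y)‖⁻¹ : ℝ) : ℂ),
    Complex.ofRealCLM.contDiff.contDiffAt.comp x (hN.inv (norm_ne_zero_iff.2 hLx)), ?_⟩
  filter_upwards [hw.continuousAt.eventually_ne hwx] with y hy
  exact star_dotProduct_inv_norm_smul_self hy

theorem exists_contDiffAt_eigenvector [Fintype ι] [DecidableEq ι] {H : E → Matrix ι ι ℂ}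
    (hH : MatrixC1At H x) {φ : E → ℝ} (hφ : ContDiffAt ℝ 1 φ x)
    (hroot : ∀ᶠ y in 𝓝 x, (H y).charpoly.eval (φ y : ℂ) = 0)
    (hsimple : (H x).charpoly.derivative.eval (φ x : ℂ) ≠ 0) :
    ∃ v : E → ι → ℂ, ContDiffAt ℝ 1 v x ∧
      ∀ᶠ y in 𝓝 x, H y *ᵥ v y = (φ y : ℂ) • v y ∧ star (v y) ⬝ᵥ v y = 1 := by
  -- The columns of the adjugate of `φ - H` are eigenvectors, and near `x` one of them is nonzero.
  obtain ⟨j, hj⟩ : ∃ j, (fun i => (scalar ι (φ x : ℂ) - H x).adjugate i j) ≠ 0 := by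
    by_contra! h
    exact adjugate_scalar_sub_ne_zero hroot.self_of_nhds hsimple
      (Matrix.ext fun i j => congrFun (h j) i)
  let w : E → ι → ℂ := fun y i => (scalar ι (φ y : ℂ) - H y).adjugate i j
  have hw : ContDiffAt ℝ 1 w x :=
    contDiffAt_pi.2 fun i => (MatrixC1At.scalar_sub hφ hH).adjugate i j
  obtain ⟨c, hc, hunit⟩ := exists_contDiffAt_normalization hw hj
  refine ⟨fun y => c y • w y, hc.smul hw, ?_⟩
  filter_upwards [hroot, hunit] with y hy hunit
  refine ⟨?_, hunit⟩
  have hker : (scalar ι (φ y : ℂ) - H y) *ᵥ w y = 0 := by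
    have h := mul_adjugate (scalar ι (φ y : ℂ) - H y)
    rw [← eval_charpoly, hy, zero_smul] at h
    exact funext fun i => congrFun (congrFun h i) j
  have hev : H y *ᵥ w y = (φ y : ℂ) • w y := by
    rw [sub_mulVec, sub_eq_zero] at hker
    rw [← hker]
    ext i
    simp [mulVec_diagonal]
  rw [mulVec_smul, hev, smul_comm]

theorem conjTranspose_mul_self_eq_one_of_eigenvectors [Fintype ι] [Fintype κ] [DecidableEq κ]
    {H : Matrix ι ι ℂ} (hH : H.IsHermitian) {φ : κ → ℝ} (hφ : Function.Injective φ)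
    {V : Matrix ι κ ℂ} (hV : H * V = V * diagonal fun k => (φ k : ℂ))
    (hunit : ∀ k, (Vᴴ * V) k k = 1) : Vᴴ * V = 1 := by
  have hcomm : (Vᴴ * V) * diagonal (fun k => (φ k : ℂ)) =
      diagonal (fun k => (φ k : ℂ)) * (Vᴴ * V) := by
    have h := congrArg Matrix.conjTranspose hV
    rw [conjTranspose_mul, conjTranspose_mul, hH.eq, diagonal_conjTranspose] at h
    rw [Matrix.mul_assoc, ← hV, ← Matrix.mul_assoc, h, Matrix.mul_assoc]
    simp [Pi.star_def]
  ext i j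
  obtain rfl | hij := eq_or_ne i j
  · rw [hunit, one_apply_eq]
  have h := congrFun (congrFun hcomm i) j
  rw [mul_diagonal, diagonal_mul, mul_comm, ← sub_eq_zero, ← sub_mul] at h
  rw [one_apply_ne hij]
  refine (mul_eq_zero.1 h).resolve_left (sub_ne_zero.2 fun h => hij ?_)
  exact hφ (Complex.ofReal_injective h).symm

theorem exists_eigenframe [CompleteSpace E] [Fintype κ] [DecidableEq κ]
    {H : E → Matrix (Fin m) (Fin m) ℂ} (hH : MatrixC1At H x)
    (hherm : ∀ᶠ y in 𝓝 x, (H y).IsHermitian) (hHx : (H x).IsHermitian)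
    {e : κ → Fin m} (he : Function.Injective e)
    (hsimple : ∀ k, ∀ i ≠ e k, eig hHx i ≠ eig hHx (e k)) :
    ∃ (φ : E → κ → ℝ) (V : E → Matrix (Fin m) κ ℂ), ContDiffAt ℝ 1 φ x ∧ MatrixC1At V x ∧
      (∀ k, φ x k = eig hHx (e k)) ∧
      ∀ᶠ y in 𝓝 x, H y * V y = V y * diagonal (fun k => (φ y k : ℂ)) ∧ (V y)ᴴ * V y = 1 := by
  choose φ hφ hφx hroot using fun k => exists_contDiffAt_eigenvalue hH hherm hHx (hsimple k)
  have hder : ∀ k, (H x).charpoly.derivative.eval (φ k x : ℂ) ≠ 0 := fun k => by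
    rw [hφx, eval_derivative_charpoly_eig]
    exact Complex.ofReal_ne_zero.2 (Finset.prod_ne_zero_iff.2 fun i hi =>
      sub_ne_zero.2 (hsimple k i (Finset.ne_of_mem_erase hi)).symm)
  choose v hv hev using fun k => exists_contDiffAt_eigenvector hH (hφ k) (hroot k) (hder k)
  have hinj : ∀ᶠ y in 𝓝 x, Function.Injective fun k => φ k y := by
    simp only [Function.Injective, eventually_all]
    intro k l
    obtain rfl | hkl := eq_or_ne k l
    · simp
    have hne : φ k x ≠ φ l x := by
      rw [hφx, hφx]
      exact hsimple l _ (he.ne hkl)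
    filter_upwards [((hφ k).continuousAt.ne_iff_eventually_ne (hφ l).continuousAt).1 hne]
      with y hy h
    exact absurd h hy
  refine ⟨fun y k => φ k y, fun y => Matrix.of fun i k => v k y i, contDiffAt_pi.2 hφ,
    fun i k => contDiffAt_pi.1 (hv k) i, hφx, ?_⟩
  filter_upwards [eventually_all.2 hev, hinj, hherm] with y hy hinj hHy
  have hV : H y * Matrix.of (fun i k => v k y i) =
      Matrix.of (fun i k => v k y i) * diagonal fun k => (φ k y : ℂ) := by
    ext i k
    rw [mul_diagonal, mul_comm]
    exact congrFun (hy k).1 i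
  exact ⟨hV, conjTranspose_mul_self_eq_one_of_eigenvectors hHy hinj hV fun k => (hy k).2⟩

theorem exists_contDiffAt_orthogonal_unit [Fintype ι] [Fintype κ] [DecidableEq κ]
    (hcard : Fintype.card κ < Fintype.card ι) {V : E → Matrix ι κ ℂ} (hV : MatrixC1At V x)
    (hVV : ∀ᶠ y in 𝓝 x, (V y)ᴴ * V y = 1) :
    ∃ w : E → ι → ℂ, ContDiffAt ℝ 1 w x ∧
      ∀ᶠ y in 𝓝 x, (V y)ᴴ *ᵥ w y = 0 ∧ star (w y) ⬝ᵥ w y = 1 := by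
  obtain ⟨w₀, hw₀, hne⟩ := Submodule.exists_mem_ne_zero_of_ne_bot
    (LinearMap.ker_ne_bot_of_finrank_lt (f := (V x)ᴴ.mulVecLin) (by simpa using hcard))
  rw [LinearMap.mem_ker, mulVecLin_apply] at hw₀
  -- Gram–Schmidt: remove from `w₀` its component in the range of `V y`.
  let w : E → ι → ℂ := fun y => w₀ - (V y * (V y)ᴴ) *ᵥ w₀
  have hw : ContDiffAt ℝ 1 w x := contDiffAt_pi.2 fun i => contDiffAt_const.sub
    (ContDiffAt.sum fun j _ => (hV.mul hV.conjTranspose i j).mul contDiffAt_const)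
  have hwx : w x = w₀ := by simp [w, ← mulVec_mulVec, hw₀]
  obtain ⟨c, hc, hunit⟩ := exists_contDiffAt_normalization hw (hwx ▸ hne)
  refine ⟨fun y => c y • w y, hc.smul hw, ?_⟩
  filter_upwards [hVV, hunit] with y hy hunit
  refine ⟨?_, hunit⟩
  simp only [w, mulVec_smul, mulVec_sub, mulVec_mulVec, ← Matrix.mul_assoc, hy, Matrix.one_mul,
    sub_self, smul_zero]

theorem exists_frame_completion [Fintype ι] [Fintype κ] [DecidableEq κ] {V : E → Matrix ι κ ℂ}
    (hV : MatrixC1At V x) (hVV : ∀ᶠ y in 𝓝 x, (V y)ᴴ * V y = 1) (p : ℕ)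
    (hcard : p + Fintype.card κ ≤ Fintype.card ι) :
    ∃ U : E → Matrix ι (Fin p ⊕ κ) ℂ, MatrixC1At U x ∧ (∀ y, (U y).toCols₂ = V y) ∧
      ∀ᶠ y in 𝓝 x, (U y)ᴴ * U y = 1 := by
  induction p with
  | zero =>
    let e : Fin 0 ⊕ κ ≃ κ := Equiv.emptySum (Fin 0) κ
    refine ⟨fun y => (V y).submatrix id e, hV.submatrix id e, fun y => rfl, ?_⟩
    filter_upwards [hVV] with y hy
    rw [conjTranspose_submatrix, ← submatrix_mul _ _ e id e Function.bijective_id, hy,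
      submatrix_one_equiv]
  | succ p ih =>
    obtain ⟨U, hU, hUV, hUU⟩ := ih (by lia)
    obtain ⟨w, hw, horth⟩ := exists_contDiffAt_orthogonal_unit
      (by simp only [Fintype.card_sum, Fintype.card_fin]; lia) hU hUU
    let e : Fin (p + 1) ⊕ κ ≃ Fin 1 ⊕ (Fin p ⊕ κ) :=
      ((finSumFinEquiv.symm.trans (Equiv.sumComm _ _)).sumCongr (.refl κ)).trans
        (Equiv.sumAssoc _ _ _)
    refine ⟨fun y => (fromCols (replicateCol (Fin 1) (w y)) (U y)).submatrix id e,
      (MatrixC1At.fromCols (fun i _ => contDiffAt_pi.1 hw i) hU).submatrix id e,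
      fun y => hUV y, ?_⟩
    filter_upwards [hUU, horth] with y hy ⟨horth, hunit⟩
    have hUw : (U y)ᴴ * replicateCol (Fin 1) (w y) = 0 := by
      rw [← replicateCol_mulVec, horth, replicateCol_zero]
    have hwU : (replicateCol (Fin 1) (w y))ᴴ * U y = 0 := by
      simpa using congrArg Matrix.conjTranspose hUw
    have hww : (replicateCol (Fin 1) (w y))ᴴ * replicateCol (Fin 1) (w y) = 1 := by
      ext i j
      obtain rfl := Subsingleton.elim i j
      simpa [Matrix.mul_apply, dotProduct] using hunit
    rw [conjTranspose_submatrix, ← submatrix_mul _ _ e id e Function.bijective_id,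
      conjTranspose_fromCols_eq_fromRows_conjTranspose, fromRows_mul_fromCols, hww, hwU, hUw, hy,
      fromBlocks_one, submatrix_one_equiv]

end EigenFrames

section BlockSchur

variable {m h : ℕ}

/-- The indices `i : Fin m` outside the coalescing pair `{h, h + 1}`. -/
abbrev OffPair (m h : ℕ) : Type := {i : Fin m // (i : ℕ) ≠ h ∧ (i : ℕ) ≠ h + 1}

/-- The splitting of `Fin m` into the pair `{h, h + 1}`, indexed by `Fin 2`, and the remaining
indices. -/
noncomputable def pairEquiv (hh : h + 1 < m) : Fin 2 ⊕ OffPair m h ≃ Fin m :=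
  Equiv.ofBijective (Sum.elim (fun k => ⟨h + k, by lia⟩) Subtype.val) <| by
    constructor
    · rintro (k | ⟨i, hi⟩) (l | ⟨j, hj⟩) hkl <;>
        simp only [Sum.elim_inl, Sum.elim_inr, Fin.ext_iff] at hkl <;>
        simp only [Sum.inl.injEq, Sum.inr.injEq, Subtype.mk.injEq, Fin.ext_iff, reduceCtorEq] <;>
        lia
    · intro i
      by_cases hi : (i : ℕ) ≠ h ∧ (i : ℕ) ≠ h + 1
      · exact ⟨.inr ⟨i, hi⟩, rfl⟩
      · exact ⟨.inl ⟨i - h, by lia⟩, Fin.ext (by simp only [Sum.elim_inl]; lia)⟩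

theorem pairEquiv_inl (hh : h + 1 < m) (k : Fin 2) :
    pairEquiv hh (.inl k) = ⟨h + k, by lia⟩ := rfl

theorem pairEquiv_inr (hh : h + 1 < m) (i : OffPair m h) : pairEquiv hh (.inr i) = i := rfl

theorem conjTranspose_mul_mul_eq_fromBlocks {ι κ κ' : Type*} [Fintype ι] [Fintype κ]
    [DecidableEq κ] [DecidableEq κ'] {H : Matrix ι ι ℂ} (hH : H.IsHermitian)
    {U : Matrix ι (κ' ⊕ κ) ℂ} (hU : Uᴴ * U = 1) {d : κ → ℂ}
    (hd : H * U.toCols₂ = U.toCols₂ * diagonal d) :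
    Uᴴ * H * U = fromBlocks (U.toCols₁ᴴ * H * U.toCols₁) 0 0 (diagonal d) := by
  have hcol : ∀ a k,
      (Uᴴ * H * U) a (.inr k) = (1 : Matrix (κ' ⊕ κ) (κ' ⊕ κ) ℂ) a (.inr k) * d k := by
    intro a k
    rw [← hU, Matrix.mul_assoc, Matrix.mul_apply, Matrix.mul_apply, Finset.sum_mul]
    refine Finset.sum_congr rfl fun i _ => ?_
    have hik : (H * U) i (.inr k) = U i (.inr k) * d k :=
      (congrFun (congrFun hd i) k).trans (mul_diagonal _ _ _ _)
    rw [hik, mul_assoc]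
  have hherm := isHermitian_conjTranspose_mul_mul U hH
  ext (i | i) (j | j)
  · rfl
  · simp [hcol]
  · rw [← hherm.apply, hcol]
    simp
  · obtain rfl | hij := eq_or_ne i j
    · simp [hcol]
    · simp [hcol, hij]

theorem charpoly_conjTranspose_mul_mul {ι κ : Type*} [Fintype ι] [Fintype κ] [DecidableEq ι]
    [DecidableEq κ] (hcard : Fintype.card ι = Fintype.card κ) (H : Matrix ι ι ℂ)
    {U : Matrix ι κ ℂ} (hU : Uᴴ * U = 1) : (Uᴴ * H * U).charpoly = H.charpoly := by
  have hU' : U * Uᴴ = 1 := (mul_eq_one_comm_of_card_eq _ _ _ hcard).2 hU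
  rw [charpoly_mul_comm_of_le _ _ hcard.le, hcard, Nat.sub_self, pow_zero, one_mul,
    ← Matrix.mul_assoc, hU', Matrix.one_mul]

theorem eig_eq_sum_elim {B : Matrix (Fin m) (Fin m) ℂ} (hB : B.IsHermitian) (hh : h + 1 < m)
    {P : Matrix (Fin 2) (Fin 2) ℂ} (hP : P.IsHermitian) {φ : OffPair m h → ℝ}
    (hc : B.charpoly = P.charpoly * (diagonal fun i => (φ i : ℂ)).charpoly) (hφ : Antitone φ)
    (hlt : ∀ i : OffPair m h, (i : ℕ) < h → ∀ k, eig hP k ≤ φ i)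
    (hgt : ∀ i : OffPair m h, h < (i : ℕ) → ∀ k, φ i ≤ eig hP k) (s : Fin 2 ⊕ OffPair m h) :
    eig hB (pairEquiv hh s) = Sum.elim (eig hP) φ s := by
  let d : Fin m → ℝ := Sum.elim (eig hP) φ ∘ (pairEquiv hh).symm
  have hd : Antitone d := by
    intro i j hij
    obtain ⟨s, rfl⟩ := (pairEquiv hh).surjective i
    obtain ⟨t, rfl⟩ := (pairEquiv hh).surjective j
    simp only [d, Function.comp_apply, Equiv.symm_apply_apply]
    rcases s with k | i <;> rcases t with l | j <;>
      simp only [pairEquiv_inl, pairEquiv_inr, Fin.le_def] at hij <;>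
      simp only [Sum.elim_inl, Sum.elim_inr]
    · exact eig_antitone hP (Fin.le_def.2 (by lia))
    · exact hgt j (by have := j.2; lia) k
    · exact hlt i (by have := i.2; lia) l
    · exact hφ hij
  have hprod : B.charpoly = ∏ i, (Polynomial.X - Polynomial.C (d i : ℂ)) := by
    rw [hc, charpoly_eq_prod_eig hP, charpoly_diagonal, ← (pairEquiv hh).prod_comp,
      Fintype.prod_sum_type]
    simp [d]
  simp [eig_eq_of_charpoly_eq_prod hB hd hprod, d]

theorem eig_block_eq {B : Matrix (Fin m) (Fin m) ℂ} (hB : B.IsHermitian) (hh : h + 1 < m)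
    {P : Matrix (Fin 2) (Fin 2) ℂ} (hP : P.IsHermitian)
    (hc : B.charpoly =
      P.charpoly * (diagonal fun i : OffPair m h => (eig hB i : ℂ)).charpoly) (k : Fin 2) :
    eig hP k = eig hB (pairEquiv hh (.inl k)) := by
  have hanti : Antitone fun k : Fin 2 => eig hB (pairEquiv hh (.inl k)) := fun k l hkl =>
    eig_antitone hB (by simpa only [pairEquiv_inl, Fin.le_def, add_le_add_iff_left] using hkl)
  refine congrFun (eig_eq_of_charpoly_eq_prod hP (d := fun k => eig hB (pairEquiv hh (.inl k)))
    hanti ?_) k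
  rw [charpoly_eq_prod_eig hB, ← (pairEquiv hh).prod_comp, Fintype.prod_sum_type,
    charpoly_diagonal] at hc
  exact (mul_right_cancel₀ (Finset.prod_ne_zero_iff.2
    fun i _ => Polynomial.X_sub_C_ne_zero _) hc).symm

theorem roots_charpoly_eq_eig {B : Matrix (Fin m) (Fin m) ℂ} (hB : B.IsHermitian) :
    B.charpoly.roots = Finset.univ.val.map fun i => (eig hB i : ℂ) := by
  rw [charpoly_eq_prod_eig hB, Polynomial.roots_prod _ _ (Finset.prod_ne_zero_iff.2
    fun i _ => Polynomial.X_sub_C_ne_zero _)]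
  simp

theorem eventually_eig_lt {E : Type*} [TopologicalSpace E] {x : E}
    {P : E → Matrix (Fin m) (Fin m) ℂ} (hP : ContinuousAt P x) (hPx : (P x).IsHermitian) {μ : ℝ}
    (hμ : ∀ k, eig hPx k = μ) {φ : E → ℝ} (hφ : ContinuousAt φ x) (hlt : μ < φ x) :
    ∀ᶠ y in 𝓝 x, ∀ (hPy : (P y).IsHermitian) k, eig hPy k < φ y := by
  obtain ⟨c, hμc, hcφ⟩ := exists_between hlt
  filter_upwards [eventually_eig_mem hP hPx isOpen_Iio fun k => (hμ k).trans_lt hμc,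
    hφ.eventually_const_lt hcφ] with y hy hyφ hPy k
  exact (hy hPy k).trans hyφ

theorem eventually_lt_eig {E : Type*} [TopologicalSpace E] {x : E}
    {P : E → Matrix (Fin m) (Fin m) ℂ} (hP : ContinuousAt P x) (hPx : (P x).IsHermitian) {μ : ℝ}
    (hμ : ∀ k, eig hPx k = μ) {φ : E → ℝ} (hφ : ContinuousAt φ x) (hlt : φ x < μ) :
    ∀ᶠ y in 𝓝 x, ∀ (hPy : (P y).IsHermitian) k, φ y < eig hPy k := by
  obtain ⟨c, hφc, hcμ⟩ := exists_between hlt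
  filter_upwards [eventually_eig_mem hP hPx isOpen_Ioi fun k => hcμ.trans_eq (hμ k).symm,
    hφ.eventually_lt_const hφc] with y hy hyφ hPy k
  exact hyφ.trans (hy hPy k)

theorem exists_isPluriRectangle_of_eventually {x : Space} {p : Space → Prop}
    (hp : ∀ᶠ y in 𝓝 x, p y) : ∃ R, IsPluriRectangle R ∧ R ∈ 𝓝 x ∧ ∀ y ∈ R, p y := by
  obtain ⟨ε, hε, hball⟩ := Metric.eventually_nhds_iff_ball.1 hp
  refine ⟨Metric.ball x ε, ⟨Metric.ball x.1.1 ε, Metric.ball x.1.2 ε, Metric.ball x.2 ε, ?_, ?_, ?_,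
    by simp only [ball_prod_same]⟩, Metric.ball_mem_nhds x hε, hball⟩
  all_goals
    rw [Real.ball_eq_Ioo]
    exact Set.ordConnected_Ioo

namespace CoalesceOnlyAt

variable {Ω : Set Space} {B : Space → Matrix (Fin m) (Fin m) ℂ}
  {hB : ∀ ξ ∈ Ω, (B ξ).IsHermitian} {x : Space}

theorem eig_lt (hc : CoalesceOnlyAt Ω B hB h x) (hx : x ∈ Ω) {i j : Fin m} (hij : i < j)
    (hne : (i : ℕ) ≠ h ∨ (j : ℕ) ≠ h + 1) : eig (hB x hx) j < eig (hB x hx) i := by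
  -- Between `i` and `j` there is a consecutive pair other than `(h, h + 1)`.
  obtain ⟨k, hk, hik, hkj, hkh⟩ :
      ∃ k, ∃ hk : k + 1 < m, i ≤ ⟨k, by lia⟩ ∧ ⟨k + 1, hk⟩ ≤ j ∧ k ≠ h := by
    rcases hne with hi | hj
    · exact ⟨i, by lia, le_rfl, hij, hi⟩
    · exact ⟨j - 1, by lia, by simp only [Fin.le_def]; lia, by simp only [Fin.le_def]; lia, by lia⟩
  calc eig (hB x hx) j ≤ eig (hB x hx) ⟨k + 1, hk⟩ := eig_antitone _ hkj
    _ < eig (hB x hx) ⟨k, by lia⟩ := (eig_antitone _ (by simp [Fin.le_def])).lt_of_ne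
        fun heq => hkh ((hc k hk x hx).1 heq.symm).1
    _ ≤ eig (hB x hx) i := eig_antitone _ hik

theorem eig_pair (hc : CoalesceOnlyAt Ω B hB h x) (hx : x ∈ Ω) (hh : h + 1 < m) (k : Fin 2) :
    eig (hB x hx) (pairEquiv hh (.inl k)) = eig (hB x hx) ⟨h, Nat.lt_of_succ_lt hh⟩ := by
  fin_cases k
  · rfl
  · exact ((hc h hh x hx).2 ⟨rfl, rfl⟩).symm

theorem eig_ne (hc : CoalesceOnlyAt Ω B hB h x) (hx : x ∈ Ω) (k : OffPair m h) {i : Fin m}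
    (hik : i ≠ k) : eig (hB x hx) i ≠ eig (hB x hx) k := by
  obtain hlt | hlt := hik.lt_or_gt
  · exact (hc.eig_lt hx hlt (.inr k.2.2)).ne'
  · exact (hc.eig_lt hx hlt (.inl k.2.1)).ne

theorem exists_adapted_frame (hc : CoalesceOnlyAt Ω B hB h x) (hx : x ∈ Ω) (hΩ : IsOpen Ω)
    (hBΩ : MatrixC1On Ω B) (hh : h + 1 < m) :
    ∃ (φ : Space → OffPair m h → ℝ) (U : Space → Matrix (Fin m) (Fin 2 ⊕ OffPair m h) ℂ),
      ContDiffAt ℝ 1 φ x ∧ MatrixC1At U x ∧ (∀ k, φ x k = eig (hB x hx) k) ∧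
      ∀ᶠ y in 𝓝 x, (U y)ᴴ * U y = 1 ∧
        B y * (U y).toCols₂ = (U y).toCols₂ * diagonal fun k => (φ y k : ℂ) := by
  have hΩx : ∀ᶠ y in 𝓝 x, y ∈ Ω := hΩ.mem_nhds hx
  obtain ⟨φ, V, hφ, hV, hφx, hev⟩ := exists_eigenframe (hBΩ.matrixC1At hΩx) (hΩx.mono hB)
    (hB x hx) Subtype.val_injective fun k i hik => hc.eig_ne hx k hik
  have hcard : 2 + Fintype.card (OffPair m h) ≤ Fintype.card (Fin m) := by
    simpa only [Fintype.card_sum, Fintype.card_fin] using (Fintype.card_congr (pairEquiv hh)).le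
  obtain ⟨U, hU, hUV, hUU⟩ := exists_frame_completion hV (hev.mono fun y hy => hy.2) 2 hcard
  refine ⟨φ, U, hφ, hU, hφx, ?_⟩
  filter_upwards [hev, hUU] with y hy hUU
  exact ⟨hUU, by rw [hUV, hy.1]⟩

theorem eventually_eig_eq (hc : CoalesceOnlyAt Ω B hB h x) (hx : x ∈ Ω) (hh : h + 1 < m)
    {φ : Space → OffPair m h → ℝ}
    (hφ : ContinuousAt φ x) (hφx : ∀ k, φ x k = eig (hB x hx) k)
    {P : Space → Matrix (Fin 2) (Fin 2) ℂ} (hP : ContinuousAt P x)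
    (hPherm : ∀ y ∈ Ω, (P y).IsHermitian)
    (hchar : ∀ᶠ y in 𝓝 x, (B y).charpoly =
      (P y).charpoly * (diagonal fun k => (φ y k : ℂ)).charpoly) :
    ∀ᶠ y in 𝓝 x, ∀ (hy : y ∈ Ω) s, eig (hB y hy) (pairEquiv hh s) =
      Sum.elim (eig (hPherm y hy)) (φ y) s := by
  have hPx : ∀ k, eig (hPherm x hx) k = eig (hB x hx) ⟨h, Nat.lt_of_succ_lt hh⟩ := fun k => by
    rw [eig_block_eq (hB x hx) hh (hPherm x hx) (by simpa only [hφx] using hchar.self_of_nhds),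
      hc.eig_pair hx]
  have hφk := continuousAt_pi.1 hφ
  have hanti : ∀ᶠ y in 𝓝 x, Antitone (φ y) := by
    simp only [Antitone, eventually_all]
    intro i j hij
    obtain rfl | hlt := hij.eq_or_lt
    · simp
    · filter_upwards [(hφk j).eventually_lt (hφk i)
        (by simpa only [hφx] using hc.eig_lt hx hlt (.inl i.2.1))] with y hy using hy.le
  have hlt : ∀ᶠ y in 𝓝 x, ∀ i : OffPair m h, (i : ℕ) < h →
      ∀ (hPy : (P y).IsHermitian) k, eig hPy k < φ y i := by
    simp only [eventually_all]
    exact fun i hi => eventually_eig_lt hP (hPherm x hx) hPx (hφk i)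
      (by simpa only [hφx] using hc.eig_lt hx hi (.inl i.2.1))
  have hgt : ∀ᶠ y in 𝓝 x, ∀ i : OffPair m h, h < (i : ℕ) →
      ∀ (hPy : (P y).IsHermitian) k, φ y i < eig hPy k := by
    simp only [eventually_all]
    exact fun i hi => eventually_lt_eig hP (hPherm x hx) hPx (hφk i)
      (by simpa only [hφx] using hc.eig_lt hx hi (.inr i.2.2))
  filter_upwards [hchar, hanti, hlt, hgt] with y hchar hanti hlt hgt hy s
  exact eig_eq_sum_elim _ hh _ hchar hanti (fun i hi k => (hlt i hi _ k).le)
    (fun i hi k => (hgt i hi _ k).le) s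

theorem exists_blockDiagonalization (hc : CoalesceOnlyAt Ω B hB h x) (hx : x ∈ Ω)
    (hΩ : IsOpen Ω) (hBΩ : MatrixC1On Ω B) (hh : h + 1 < m) :
    ∃ (U : Space → Matrix (Fin m) (Fin 2 ⊕ OffPair m h) ℂ) (P : Space → Matrix (Fin 2) (Fin 2) ℂ)
      (φ : Space → OffPair m h → ℝ), MatrixC1At U x ∧ MatrixC1At P x ∧ ContDiffAt ℝ 1 φ x ∧
      ∀ᶠ y in 𝓝 x, (U y)ᴴ * U y = 1 ∧
        (U y)ᴴ * B y * U y = fromBlocks (P y) 0 0 (diagonal fun k => (φ y k : ℂ)) ∧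
        ∀ hy : y ∈ Ω, ∃ hP : (P y).IsHermitian,
          ∀ s, eig (hB y hy) (pairEquiv hh s) = Sum.elim (eig hP) (φ y) s := by
  obtain ⟨φ, U, hφ, hU, hφx, hframe⟩ := hc.exists_adapted_frame hx hΩ hBΩ hh
  have hΩx : ∀ᶠ y in 𝓝 x, y ∈ Ω := hΩ.mem_nhds hx
  let P : Space → Matrix (Fin 2) (Fin 2) ℂ := fun y => (U y).toCols₁ᴴ * B y * (U y).toCols₁
  have hP : MatrixC1At P x := (hU.toCols₁.conjTranspose.mul (hBΩ.matrixC1At hΩx)).mul hU.toCols₁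
  have hPherm : ∀ y ∈ Ω, (P y).IsHermitian := fun y hy =>
    isHermitian_conjTranspose_mul_mul _ (hB y hy)
  have hblock : ∀ᶠ y in 𝓝 x,
      (U y)ᴴ * B y * U y = fromBlocks (P y) 0 0 (diagonal fun k => (φ y k : ℂ)) := by
    filter_upwards [hframe, hΩx] with y ⟨hUU, hBU⟩ hy
    exact conjTranspose_mul_mul_eq_fromBlocks (hB y hy) hUU hBU
  have heig := hc.eventually_eig_eq hx hh hφ.continuousAt hφx hP.continuousAt hPherm <| by
    filter_upwards [hframe, hblock] with y hy hblock
    rw [← charpoly_fromBlocks_zero₁₂, ← hblock,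
      charpoly_conjTranspose_mul_mul (Fintype.card_congr (pairEquiv hh)).symm _ hy.1]
  refine ⟨U, P, φ, hU, hP, hφ, ?_⟩
  filter_upwards [hframe, hblock, heig] with y hframe hblock heig
  exact ⟨hframe.1, hblock, fun hy => ⟨hPherm y hy, heig hy⟩⟩

theorem exists_isBlockSchur (hc : CoalesceOnlyAt Ω B hB h x) (hx : x ∈ Ω) (hΩ : IsOpen Ω)
    (hBΩ : MatrixC1On Ω B) (hh : h + 1 < m) :
    ∃ R U P L, IsBlockSchur Ω B hB h hh x R U P L := by
  obtain ⟨U, P, φ, hU, hP, hφ, hdiag⟩ := hc.exists_blockDiagonalization hx hΩ hBΩ hh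
  have hL : MatrixC1At (fun y => diagonal fun k => (φ y k : ℂ)) x :=
    .diagonal fun k => Complex.ofRealCLM.contDiff.contDiffAt.comp x (contDiffAt_pi.1 hφ k)
  obtain ⟨R, hR, hRx, hgood⟩ := exists_isPluriRectangle_of_eventually
    ((hΩ.eventually_mem hx).and
      (hU.eventually.and (hP.eventually.and (hL.eventually.and hdiag))))
  simp only [imp_and, forall_and] at hgood
  obtain ⟨hRΩ, hUR, hPR, hLR, hUU, hblock, heig⟩ := hgood
  have hUU' : ∀ y ∈ R, U y * (U y)ᴴ = 1 := fun y hy =>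
    (mul_eq_one_comm_of_equiv (pairEquiv hh).symm).2 (hUU y hy)
  refine ⟨R, U, P, _, hR, hRΩ, mem_interior_iff_mem_nhds.2 hRx,
    fun i j y hy => (hUR y hy i j).contDiffWithinAt,
    fun i j y hy => (hPR y hy i j).contDiffWithinAt,
    fun i j y hy => (hLR y hy i j).contDiffWithinAt, hUU, hUU',
    fun y hy => ?_, fun y hy => ?_, fun y hy => ?_⟩
  · simp only [← hblock y hy, Matrix.mul_assoc, hUU' y hy, Matrix.mul_one]
    rw [← Matrix.mul_assoc, hUU' y hy, Matrix.one_mul]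
  · obtain ⟨hPy, h⟩ := heig y hy (hRΩ y hy)
    exact congrArg diagonal (funext fun k => congrArg Complex.ofReal (h (.inr k)).symm)
  · obtain ⟨hPy, h⟩ := heig y hy (hRΩ y hy)
    have hpair : ∀ k, eig hPy k = _ := fun k => (h (.inl k)).symm
    simp only [roots_charpoly_eq_eig hPy, hpair]
    rfl

end CoalesceOnlyAt

end BlockSchur

section Criterion

theorem isRegularZero_iff_of_hasFDerivAt {E G : Type*} [NormedAddCommGroup E] [NormedSpace ℝ E]
    [FiniteDimensional ℝ E] [NormedAddCommGroup G] [NormedSpace ℝ G] [FiniteDimensional ℝ G]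
    (hEG : Module.finrank ℝ E = Module.finrank ℝ G) {F : E → G} {F' : E →L[ℝ] G} {x : E}
    (hF : HasFDerivAt F F' x) (h0 : F x = 0) : IsRegularZero F x ↔ ∀ v, F' v = 0 → v = 0 := by
  constructor
  · rintro ⟨-, e, he⟩ v hv
    rw [hF.unique he] at hv
    exact e.injective (by simpa using hv)
  · intro h
    have hinj : Function.Injective (F' : E →ₗ[ℝ] G) := (injective_iff_map_eq_zero _).2 h
    exact ⟨h0, (LinearEquiv.ofInjectiveOfFinrankEq _ hinj hEG).toContinuousLinearEquiv, hF⟩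

theorem coalescenceMap_eq_zero_iff {P : Matrix (Fin 2) (Fin 2) ℂ} (hP : P.IsHermitian) :
    coalescenceMap P = 0 ↔ ∃ c : ℂ, P = c • 1 := by
  simp only [coalescenceMap, Prod.mk_eq_zero, sub_eq_zero]
  constructor
  · rintro ⟨hre, h01re, h01im⟩
    have h01 : P 0 1 = 0 := Complex.ext h01re h01im
    have h10 : P 1 0 = 0 := by rw [← hP.apply, h01, star_zero]
    have him : ∀ i, (P i i).im = 0 := fun i => Complex.conj_eq_iff_im.1 (hP.apply i i)
    have h11 : P 1 1 = P 0 0 := Complex.ext hre.symm (by rw [him, him])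
    refine ⟨P 0 0, ?_⟩
    ext i j
    fin_cases i <;> fin_cases j <;> simp [h01, h10, h11]
  · rintro ⟨c, rfl⟩
    simp

theorem conjTranspose_mul_mul_eq_smul_one_iff {ι κ : Type*} [Fintype ι] [Fintype κ]
    [DecidableEq ι] [DecidableEq κ] {X : Matrix ι ι ℂ} {Q : Matrix ι κ ℂ} (hQ : Qᴴ * Q = 1)
    (hQ' : Q * Qᴴ = 1) {c : ℂ} : Qᴴ * X * Q = c • 1 ↔ X = c • 1 := by
  constructor
  · intro h
    have hX : Q * (Qᴴ * X * Q) * Qᴴ = X := by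
      simp only [Matrix.mul_assoc, hQ', Matrix.mul_one]
      rw [← Matrix.mul_assoc, hQ', Matrix.one_mul]
    rw [← hX, h, Matrix.mul_smul, Matrix.smul_mul, Matrix.mul_one, hQ']
  · rintro rfl
    rw [Matrix.mul_smul, Matrix.smul_mul, Matrix.mul_one, hQ]

theorem isRegularZero_coalescenceMap_iff {P : Space → Matrix (Fin 2) (Fin 2) ℂ} {x : Space}
    (hP : MatrixC1At P x) (hherm : ∀ᶠ y in 𝓝 x, (P y).IsHermitian) {c₀ : ℂ}
    (hPx : P x = c₀ • 1) : IsRegularZero (fun y => coalescenceMap (P y)) x ↔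
      ∀ v, (∃ c : ℂ, matrixFDeriv P x v = c • 1) → v = 0 := by
  have hderiv := fun i j => (hP.differentiableAt i j).hasFDerivAt
  have hF : HasFDerivAt (fun y => coalescenceMap (P y)) _ x :=
    ((Complex.reCLM.hasFDerivAt.comp x (hderiv 0 0)).sub
      (Complex.reCLM.hasFDerivAt.comp x (hderiv 1 1))).prodMk
      ((Complex.reCLM.hasFDerivAt.comp x (hderiv 0 1)).prodMk
        (Complex.imCLM.hasFDerivAt.comp x (hderiv 0 1)))
  have hP' : ∀ v, (matrixFDeriv P x v).IsHermitian := fun v => by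
    rw [Matrix.IsHermitian, ← hP.matrixFDeriv_conjTranspose]
    exact matrixFDeriv_congr hherm v
  have h0 := (coalescenceMap_eq_zero_iff (hPx ▸ hherm.self_of_nhds)).2 ⟨c₀, rfl⟩
  rw [← hPx] at h0
  rw [isRegularZero_iff_of_hasFDerivAt (by simp) hF h0]
  exact forall_congr' fun v => imp_congr_left (coalescenceMap_eq_zero_iff (hP' v))

variable {m h : ℕ} {Ω : Set Space} {B : Space → Matrix (Fin m) (Fin m) ℂ}
  {hB : ∀ ξ ∈ Ω, (B ξ).IsHermitian} {x : Space}

namespace IsBlockSchur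

variable {hh : h + 1 < m} {R : Set Space} {U : Space → Matrix (Fin m) (Fin 2 ⊕ OffPair m h) ℂ}
  {P : Space → Matrix (Fin 2) (Fin 2) ℂ} {L : Space → Matrix (OffPair m h) (OffPair m h) ℂ}
  {y : Space}

theorem mem_nhds (S : IsBlockSchur Ω B hB h hh x R U P L) : R ∈ 𝓝 x :=
  mem_interior_iff_mem_nhds.1 S.mem_interior

theorem conjTranspose_mul_mul (S : IsBlockSchur Ω B hB h hh x R U P L) (hy : y ∈ R) :
    (U y)ᴴ * B y * U y = fromBlocks (P y) 0 0 (L y) := by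
  rw [S.decomp y hy, Matrix.mul_assoc, Matrix.mul_assoc, S.unitary_left y hy, Matrix.mul_one,
    ← Matrix.mul_assoc, S.unitary_left y hy, Matrix.one_mul]

theorem P_eq (S : IsBlockSchur Ω B hB h hh x R U P L) (hy : y ∈ R) :
    P y = (U y).toCols₁ᴴ * B y * (U y).toCols₁ :=
  (congrArg toBlocks₁₁ (S.conjTranspose_mul_mul hy)).symm

theorem isHermitian_P (S : IsBlockSchur Ω B hB h hh x R U P L) (hy : y ∈ R) :
    (P y).IsHermitian := by
  rw [S.P_eq hy]
  exact isHermitian_conjTranspose_mul_mul _ (hB y (S.subset hy))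

theorem toCols₁_orthonormal (S : IsBlockSchur Ω B hB h hh x R U P L) (hy : y ∈ R) :
    (U y).toCols₁ᴴ * (U y).toCols₁ = 1 :=
  (congrArg toBlocks₁₁ (S.unitary_left y hy)).trans <| by
    rw [← fromBlocks_one, toBlocks_fromBlocks₁₁]

theorem P_eq_smul_one (S : IsBlockSchur Ω B hB h hh x R U P L)
    (hc : CoalesceOnlyAt Ω B hB h x) (hx : x ∈ Ω) :
    P x = (eig (hB x hx) ⟨h, Nat.lt_of_succ_lt hh⟩ : ℂ) • 1 := by
  have hxR := mem_of_mem_nhds S.mem_nhds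
  refine eq_smul_one_of_eig_eq (S.isHermitian_P hxR) fun i => ?_
  have hroot : (eig (S.isHermitian_P hxR) i : ℂ) ∈ (P x).charpoly.roots := by
    rw [roots_charpoly_eq_eig (S.isHermitian_P hxR)]
    exact Multiset.mem_map_of_mem _ (Finset.mem_univ i)
  rw [S.eig_P x hxR, ← (hc h hh x hx).2 ⟨rfl, rfl⟩] at hroot
  simpa using hroot

theorem mul_toCols₁ (S : IsBlockSchur Ω B hB h hh x R U P L) (hy : y ∈ R) :
    B y * (U y).toCols₁ = (U y).toCols₁ * P y := by
  have hBU : B y * U y = U y * fromBlocks (P y) 0 0 (L y) := by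
    rw [← S.conjTranspose_mul_mul hy, ← Matrix.mul_assoc, ← Matrix.mul_assoc,
      S.unitary_right y hy, Matrix.one_mul]
  nth_rw 1 2 [← fromCols_toCols (U y)] at hBU
  rw [fromCols_mul_fromBlocks, mul_fromCols] at hBU
  simpa using congrArg toCols₁ hBU

theorem conjTranspose_toCols₂_mul (S : IsBlockSchur Ω B hB h hh x R U P L) (hy : y ∈ R) :
    (U y).toCols₂ᴴ * B y = L y * (U y).toCols₂ᴴ := by
  have hUB : (U y)ᴴ * B y = fromBlocks (P y) 0 0 (L y) * (U y)ᴴ := by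
    rw [← S.conjTranspose_mul_mul hy, Matrix.mul_assoc, S.unitary_right y hy, Matrix.mul_one]
  nth_rw 1 2 [← fromCols_toCols (U y)] at hUB
  rw [conjTranspose_fromCols_eq_fromRows_conjTranspose, fromBlocks_mul_fromRows,
    fromRows_mul] at hUB
  simpa using congrArg toRows₂ hUB

variable {κ : Type*} {K : Matrix (Fin m) κ ℂ}

theorem toCols₁_mul_conjTranspose_mul (S : IsBlockSchur Ω B hB h hh x R U P L)
    (hc : CoalesceOnlyAt Ω B hB h x) (hx : x ∈ Ω)
    (hBK : B x * K = (eig (hB x hx) ⟨h, Nat.lt_of_succ_lt hh⟩ : ℂ) • K) :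
    (U x).toCols₁ * ((U x).toCols₁ᴴ * K) = K := by
  have hxR := mem_of_mem_nhds S.mem_nhds
  have hU₂K : (U x).toCols₂ᴴ * K = 0 := by
    have hL := S.conjTranspose_toCols₂_mul hxR
    rw [S.eig_L x hxR] at hL
    have hLK := congrArg (· * K) hL
    simp only [Matrix.mul_assoc, hBK, Matrix.mul_smul] at hLK
    ext i k
    have hik := congrFun (congrFun hLK i) k
    rw [diagonal_mul, Matrix.smul_apply, smul_eq_mul, ← sub_eq_zero, ← sub_mul] at hik
    refine (mul_eq_zero.1 hik).resolve_left (sub_ne_zero.2 (Complex.ofReal_injective.ne ?_))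
    exact hc.eig_ne hx i (Fin.ne_of_val_ne i.2.1.symm)
  have hUU := S.unitary_right x hxR
  rw [← fromCols_toCols (U x), conjTranspose_fromCols_eq_fromRows_conjTranspose,
    fromCols_mul_fromRows] at hUU
  calc (U x).toCols₁ * ((U x).toCols₁ᴴ * K)
      = ((U x).toCols₁ * (U x).toCols₁ᴴ + (U x).toCols₂ * (U x).toCols₂ᴴ) * K := by
        rw [Matrix.add_mul, Matrix.mul_assoc, Matrix.mul_assoc, hU₂K, Matrix.mul_zero, add_zero]
    _ = K := by rw [hUU, Matrix.one_mul]

theorem isRegularZero_iff [Fintype κ] [DecidableEq κ] (S : IsBlockSchur Ω B hB h hh x R U P L)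
    (hc : CoalesceOnlyAt Ω B hB h x) (hx : x ∈ Ω) (hBx : MatrixC1At B x)
    (hcard : Fintype.card κ = 2) (hKK : Kᴴ * K = 1)
    (hBK : B x * K = (eig (hB x hx) ⟨h, Nat.lt_of_succ_lt hh⟩ : ℂ) • K) :
    IsRegularZero (fun y => coalescenceMap (P y)) x ↔
      ∀ v, (∃ c : ℂ, Kᴴ * matrixFDeriv B x v * K = c • 1) → v = 0 := by
  have hxR := mem_of_mem_nhds S.mem_nhds
  have hPx := S.P_eq_smul_one hc hx
  have hW : MatrixC1At (fun y => (U y).toCols₁) x := (S.smooth_U.matrixC1At S.mem_nhds).toCols₁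
  have hder : ∀ v, matrixFDeriv P x v =
      (U x).toCols₁ᴴ * matrixFDeriv B x v * (U x).toCols₁ := fun v => by
    rw [← hBx.matrixFDeriv_compression hW (hB x hx)
      (mem_of_superset S.mem_nhds fun y => S.toCols₁_orthonormal)
      (by rw [S.mul_toCols₁ hxR, hPx, Matrix.mul_smul, Matrix.mul_one])]
    exact matrixFDeriv_congr (mem_of_superset S.mem_nhds fun y => S.P_eq) v
  -- `Q` is the unitary change of basis between the two frames of the eigenspace.
  obtain ⟨Q, hQ⟩ : ∃ Q, Q = (U x).toCols₁ᴴ * K := ⟨_, rfl⟩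
  have hK : (U x).toCols₁ * Q = K := hQ ▸ S.toCols₁_mul_conjTranspose_mul hc hx hBK
  have hQQ : Qᴴ * Q = 1 := by
    rw [← hKK, ← hK, conjTranspose_mul, Matrix.mul_assoc, ← Matrix.mul_assoc _ _ Q,
      S.toCols₁_orthonormal hxR, Matrix.one_mul]
  have hQQ' : Q * Qᴴ = 1 := (mul_eq_one_comm_of_card_eq _ _ _ (by simp [hcard])).2 hQQ
  rw [isRegularZero_coalescenceMap_iff (S.smooth_P.matrixC1At S.mem_nhds)
    (mem_of_superset S.mem_nhds fun y => S.isHermitian_P) hPx]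
  refine forall_congr' fun v => imp_congr_left (exists_congr fun c => ?_)
  have hKv : Kᴴ * matrixFDeriv B x v * K = Qᴴ * matrixFDeriv P x v * Q := by
    rw [hder, ← hK, conjTranspose_mul]
    simp only [Matrix.mul_assoc]
  rw [hKv]
  exact (conjTranspose_mul_mul_eq_smul_one_iff hQQ hQQ').symm

end IsBlockSchur

theorem CoalesceOnlyAt.isGenericCoalescence_iff (hc : CoalesceOnlyAt Ω B hB h x) (hx : x ∈ Ω)
    (hΩ : IsOpen Ω) (hBΩ : MatrixC1On Ω B) (hh : h + 1 < m) (hm : 2 < m)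
    {κ : Type*} [Fintype κ] [DecidableEq κ] (hcard : Fintype.card κ = 2) {K : Matrix (Fin m) κ ℂ}
    (hKK : Kᴴ * K = 1)
    (hBK : B x * K = (eig (hB x hx) ⟨h, Nat.lt_of_succ_lt hh⟩ : ℂ) • K) :
    IsGenericCoalescence Ω B hB x ↔
      ∀ v, (∃ c : ℂ, Kᴴ * matrixFDeriv B x v * K = c • 1) → v = 0 := by
  have hBx := hBΩ.matrixC1At (hΩ.mem_nhds hx)
  constructor
  · rintro ⟨-, h', hh', hc', -, hS⟩
    obtain rfl : h' = h := ((hc h' hh' x hx).1 ((hc' h' hh' x hx).2 ⟨rfl, rfl⟩)).1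
    obtain ⟨⟨R, U, P, L, S⟩, hreg⟩ := hS hm
    exact (S.isRegularZero_iff hc hx hBx hcard hKK hBK).1 (hreg R U P L S)
  · intro hv
    exact ⟨hx, h, hh, hc, fun hm2 => absurd hm2 hm.ne', fun _ =>
      ⟨hc.exists_isBlockSchur hx hΩ hBΩ hh, fun R U P L S =>
        (S.isRegularZero_iff hc hx hBx hcard hKK hBK).2 hv⟩⟩

end Criterion

section LossOfRank

variable {n : ℕ} {A : Matrix (Fin n) (Fin n) ℂ}

theorem eig_conjTranspose_mul_self (A : Matrix (Fin n) (Fin n) ℂ) (j : Fin n) :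
    eig (isHermitian_conjTranspose_mul_self A) j = singVal A j ^ 2 := by
  have h : toEuclideanLin (Aᴴ * A) = (toEuclideanLin A).adjoint ∘ₗ toEuclideanLin A := by
    rw [← toEuclideanLin_conjTranspose_eq_adjoint]
    ext
    simp [toLpLin_apply]
  rw [singVal]
  refine Eq.trans ?_ ((toEuclideanLin A).sq_singularValues_fin finrank_euclideanSpace
    (Fin.cast (Fintype.card_fin n).symm j)).symm
  simp only [eig, IsHermitian.eigenvalues₀, h]

theorem singVal_nonneg (A : Matrix (Fin n) (Fin n) ℂ) (j : Fin n) : 0 ≤ singVal A j :=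
  (toEuclideanLin A).singularValues_nonneg j

theorem singVal_antitone (A : Matrix (Fin n) (Fin n) ℂ) : Antitone (singVal A) :=
  fun _ _ hij => (toEuclideanLin A).singularValues_antitone hij

theorem singVal_eq_zero_iff {j : Fin n} : singVal A j = 0 ↔ A.rank ≤ j := by
  rw [singVal, LinearMap.singularValues_eq_zero_iff_le_finrank_range,
    rank_eq_finrank_range_toLin A (EuclideanSpace.basisFun _ ℂ).toBasis
      (EuclideanSpace.basisFun _ ℂ).toBasis]
  rfl

theorem rank_add_one_eq (hσ : Function.Injective (singVal A)) (hr : A.rank < n) :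
    A.rank + 1 = n := by
  have hlast : singVal A ⟨A.rank, hr⟩ = singVal A ⟨n - 1, by omega⟩ := by
    rw [singVal_eq_zero_iff.2 le_rfl, singVal_eq_zero_iff.2 (Nat.le_sub_one_of_lt hr)]
  have := congrArg Fin.val (hσ hlast)
  grind

theorem exists_unit_of_mulVec_eq_zero {ι : Type*} [Fintype ι] {A : Matrix ι ι ℂ} {w : ι → ℂ}
    (hw : w ≠ 0) (hAw : A *ᵥ w = 0) : ∃ a : ℂ, a ≠ 0 ∧ star (a • w) ⬝ᵥ (a • w) = 1 ∧
      A *ᵥ (a • w) = 0 :=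
  ⟨((‖WithLp.toLp 2 w‖⁻¹ : ℝ) : ℂ), by simpa using hw, star_dotProduct_inv_norm_smul_self hw,
    by rw [mulVec_smul, hAw, smul_zero]⟩

theorem exists_unit_kernel_generator {ι : Type*} [Fintype ι] {A : Matrix ι ι ℂ}
    (hr : A.rank + 1 = Fintype.card ι) : ∃ v : ι → ℂ, star v ⬝ᵥ v = 1 ∧ A *ᵥ v = 0 ∧
      ∀ w, A *ᵥ w = 0 → ∃ c : ℂ, c • v = w := by
  have hker : Module.finrank ℂ (LinearMap.ker A.mulVecLin) = 1 := by
    have := A.mulVecLin.finrank_range_add_finrank_ker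
    rw [Module.finrank_fintype_fun_eq_card, ← hr] at this
    exact Nat.add_left_cancel this
  obtain ⟨⟨w, hAw⟩, hw, hspan⟩ := finrank_eq_one_iff'.1 hker
  obtain ⟨a, ha, hunit, hAv⟩ := exists_unit_of_mulVec_eq_zero (fun h => hw (Subtype.ext h)) hAw
  refine ⟨a • w, hunit, hAv, fun w' hw' => ?_⟩
  obtain ⟨c, hc⟩ := hspan ⟨w', hw'⟩
  exact ⟨c * a⁻¹, by rw [smul_smul, inv_mul_cancel_right₀ ha]; exact congrArg Subtype.val hc⟩

theorem exists_unit_cokernel {ι : Type*} [Fintype ι] [DecidableEq ι] {A : Matrix ι ι ℂ}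
    (hdet : A.det = 0) : ∃ u : ι → ℂ, star u ⬝ᵥ u = 1 ∧ Aᴴ *ᵥ u = 0 := by
  obtain ⟨w, hw, hAw⟩ := exists_mulVec_eq_zero_iff.2
    (show Aᴴ.det = 0 by rw [det_conjTranspose, hdet, star_zero])
  obtain ⟨a, -, hu⟩ := exists_unit_of_mulVec_eq_zero hw hAw
  exact ⟨a • w, hu⟩

-- A zero singular value that is simple is a simple root of the characteristic polynomial of `A* A`.
theorem adjugate_ne_zero_of_singVal_injective (hσ : Function.Injective (singVal A))
    (hr : A.rank < n) : A.adjugate ≠ 0 := by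
  let hH := isHermitian_conjTranspose_mul_self A
  let j : Fin n := ⟨A.rank, hr⟩
  have hj : eig hH j = 0 := by
    rw [eig_conjTranspose_mul_self, singVal_eq_zero_iff.2 le_rfl, zero_pow two_ne_zero]
  have hinj : Function.Injective (eig hH) := fun i k hik => hσ <| by
    simpa [eig_conjTranspose_mul_self, singVal_nonneg] using hik
  have hadj := adjugate_scalar_sub_ne_zero (μ := eig hH j) (eval_charpoly_eig hH j) <| by
    rw [eval_derivative_charpoly_eig, Complex.ofReal_ne_zero, Finset.prod_ne_zero_iff]
    exact fun i hi => sub_ne_zero.2 (hinj.ne (Finset.ne_of_mem_erase hi).symm)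
  intro hA
  rw [hj, Complex.ofReal_zero, map_zero, zero_sub, ← Matrix.neg_mul, adjugate_mul_distrib, hA,
    Matrix.zero_mul] at hadj
  exact hadj rfl

theorem adjugate_eq_vecMulVec {ι : Type*} [Fintype ι] [DecidableEq ι] {A : Matrix ι ι ℂ}
    (hdet : A.det = 0) {v : ι → ℂ} (hker : ∀ w, A *ᵥ w = 0 → ∃ c : ℂ, c • v = w) :
    ∃ d, A.adjugate = vecMulVec v d := by
  have hcol : ∀ j, A *ᵥ A.adjugate.col j = 0 := fun j =>
    funext fun i => (congrFun₂ (mul_adjugate A) i j).trans (by simp [hdet])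
  choose d hd using fun j => hker _ (hcol j)
  refine ⟨d, ?_⟩
  ext i j
  simpa [vecMulVec_apply, mul_comm] using (congrFun (hd j) i).symm

theorem MatrixC1At.fderiv_det_eq_zero_iff {E : Type*} [NormedAddCommGroup E] [NormedSpace ℝ E]
    {ι : Type*} [Fintype ι] [DecidableEq ι] {A : E → Matrix ι ι ℂ} {x : E} (hA : MatrixC1At A x)
    (hdet : (A x).det = 0) (hadj : (A x).adjugate ≠ 0) {u v : ι → ℂ} (hu : star u ⬝ᵥ u = 1)
    (hAu : (A x)ᴴ *ᵥ u = 0) (hker : ∀ w, A x *ᵥ w = 0 → ∃ c : ℂ, c • v = w) (w : E) :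
    fderiv ℝ (fun y => (A y).det) x w = 0 ↔ star u ⬝ᵥ (matrixFDeriv A x w *ᵥ v) = 0 := by
  obtain ⟨d, hd⟩ := adjugate_eq_vecMulVec hdet hker
  have hd0 : d ≠ 0 := by
    rintro rfl
    exact hadj (by rw [hd, vecMulVec_zero])
  have hu0 : star u ≠ 0 := fun h => by simp [h] at hu
  have huA : star u ᵥ* A x = 0 := by simpa [star_mulVec] using congrArg star hAu
  have key : fderiv ℝ (fun y => (A y).det) x w • star u =
      (star u ⬝ᵥ (matrixFDeriv A x w *ᵥ v)) • d := by
    have := congrArg (star u ᵥ* ·) (hA.fderiv_det_smul_one w)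
    simpa [vecMul_smul, vecMul_add, ← vecMul_vecMul, huA, hd, vecMul_vecMulVec,
      dotProduct_mulVec] using this
  rw [← smul_eq_zero_iff_left hu0, key, smul_eq_zero_iff_left hd0]

theorem isGenericLossOfRank_iff {A : Plane → Matrix (Fin n) (Fin n) ℂ} {ξ : Plane}
    (hA : MatrixC1At A ξ) (hdet : (A ξ).det = 0) : IsGenericLossOfRank A ξ ↔
      ∀ w, fderiv ℝ (fun y => (A y).det) ξ w = 0 → w = 0 := by
  have hd := (hA.det.differentiableAt one_ne_zero).hasFDerivAt
  have hF : HasFDerivAt (fun y => ((A y).det.re, (A y).det.im)) _ ξ :=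
    (Complex.reCLM.hasFDerivAt.comp ξ hd).prodMk (Complex.imCLM.hasFDerivAt.comp ξ hd)
  rw [IsGenericLossOfRank, isRegularZero_iff_of_hasFDerivAt (by simp) hF (by simp [hdet])]
  simp [Complex.ext_iff]

end LossOfRank

section SpectrumOfM

variable {n : ℕ}

/-- The list `f₀, …, f_{n-1}, -f_{n-1}, …, -f₀`, which is decreasing when `f` is nonnegative and
decreasing: the shape of the spectrum of `M(ξ, ε)`. -/
noncomputable def signedAppend (f : Fin n → ℝ) : Fin (n + n) → ℝ :=
  Fin.append f fun j => -f j.rev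

theorem signedAppend_of_lt (f : Fin n → ℝ) {j : ℕ} (hj : j < n) (hj' : j < n + n) :
    signedAppend f ⟨j, hj'⟩ = f ⟨j, hj⟩ :=
  Fin.append_left f _ ⟨j, hj⟩

theorem signedAppend_of_ge (f : Fin n → ℝ) {j : ℕ} (hj : n ≤ j) (hj' : j < n + n) :
    signedAppend f ⟨j, hj'⟩ = -f ⟨n + n - (j + 1), by omega⟩ := by
  have h : (⟨j, hj'⟩ : Fin (n + n)) = Fin.natAdd n ⟨j - n, by omega⟩ := by
    ext
    simp [hj]
  rw [h, signedAppend, Fin.append_right]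
  congr 2
  ext
  simp only [Fin.val_rev]
  omega

theorem antitone_signedAppend {f : Fin n → ℝ} (hf : Antitone f) (hf0 : 0 ≤ f) :
    Antitone (signedAppend f) := by
  rintro ⟨i, hi'⟩ ⟨j, hj'⟩ hij
  rw [Fin.mk_le_mk] at hij
  rcases lt_or_ge j n with hj | hj
  · rw [signedAppend_of_lt f hj, signedAppend_of_lt f (hij.trans_lt hj)]
    exact hf (Fin.mk_le_mk.2 hij)
  rcases lt_or_ge i n with hi | hi
  · rw [signedAppend_of_ge f hj, signedAppend_of_lt f hi]
    exact (neg_nonpos.2 (hf0 _)).trans (hf0 _)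
  · rw [signedAppend_of_ge f hj, signedAppend_of_ge f hi]
    exact neg_le_neg (hf (Fin.mk_le_mk.2 (by omega)))

theorem signedAppend_eq_succ_iff {f : Fin n → ℝ} (hf : StrictAnti f) {j : ℕ} (hj : j + 1 < n + n) :
    signedAppend f ⟨j, Nat.lt_of_succ_lt hj⟩ = signedAppend f ⟨j + 1, hj⟩ ↔
      ∃ h : j + 1 = n, f ⟨j, by omega⟩ = 0 := by
  rcases lt_trichotomy (j + 1) n with hjn | hjn | hjn
  · rw [signedAppend_of_lt f hjn, signedAppend_of_lt f (Nat.lt_of_succ_lt hjn)]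
    exact iff_of_false (hf (Fin.mk_lt_mk.2 j.lt_succ_self)).ne' fun h => hjn.ne h.1
  · rw [signedAppend_of_ge f hjn.ge, signedAppend_of_lt f (by omega : j < n)]
    have hmirror : f ⟨n + n - (j + 1 + 1), by omega⟩ = f ⟨j, by omega⟩ := by
      congr
      omega
    rw [hmirror, self_eq_neg, exists_prop_of_true hjn]
  · rw [signedAppend_of_ge f hjn.le, signedAppend_of_ge f (Nat.le_of_lt_succ hjn), neg_inj]
    refine iff_of_false (hf (Fin.mk_lt_mk.2 ?_)).ne fun h => hjn.ne' h.1
    omega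

theorem prod_X_sub_C_signedAppend (f : Fin n → ℝ) :
    ∏ i, (Polynomial.X - Polynomial.C (signedAppend f i : ℂ)) =
      ∏ j, (Polynomial.X ^ 2 - Polynomial.C ((f j : ℂ) ^ 2)) := by
  have hrev : ∏ j : Fin n, (Polynomial.X - Polynomial.C ((-f j.rev : ℝ) : ℂ)) =
      ∏ j, (Polynomial.X - Polynomial.C ((-f j : ℝ) : ℂ)) :=
    Equiv.prod_comp Fin.revPerm fun j => Polynomial.X - Polynomial.C ((-f j : ℝ) : ℂ)
  simp only [Fin.prod_univ_add, signedAppend, Fin.append_left, Fin.append_right]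
  rw [hrev, ← Finset.prod_mul_distrib]
  refine Finset.prod_congr rfl fun j _ => ?_
  simp only [Complex.ofReal_neg, map_neg, map_pow]
  ring

theorem det_fromBlocks_smul_one {R ι : Type*} [CommRing R] [IsDomain R] [Fintype ι]
    [DecidableEq ι] {a : R} (ha : a ≠ 0) (d : R) (B C : Matrix ι ι R) :
    (fromBlocks (a • 1) B C (d • 1)).det = ((a * d) • 1 - C * B).det := by
  have hprod : fromBlocks (a • 1) B C (d • 1) * fromBlocks 1 (-B) 0 (a • 1) =
      fromBlocks (a • 1) 0 C ((a * d) • 1 - C * B) := by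
    simp [fromBlocks_multiply, smul_smul, sub_eq_neg_add]
  have hdet := congrArg det hprod
  rw [det_mul, det_fromBlocks_zero₂₁, det_fromBlocks_zero₁₂, det_one, one_mul, mul_comm] at hdet
  exact mul_left_cancel₀ (by simp [ha]) hdet

theorem det_smul_one_sub_map_C {R ι : Type*} [CommRing R] [Fintype ι] [DecidableEq ι]
    (p : Polynomial R) (H : Matrix ι ι R) :
    (p • (1 : Matrix ι ι (Polynomial R)) - H.map Polynomial.C).det = H.charpoly.comp p := by
  rw [charpoly, ← Polynomial.coe_compRingHom_apply, RingHom.map_det]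
  congr 1
  ext i j
  by_cases hij : i = j <;> simp [hij, one_apply]

theorem charpoly_hermitianM (A : Plane → Matrix (Fin n) (Fin n) ℂ) (η : Space) :
    (hermitianM A η).charpoly = ((A η.1)ᴴ * A η.1).charpoly.comp
      (Polynomial.X ^ 2 - Polynomial.C ((η.2 : ℂ) ^ 2)) := by
  have hchar : ∀ c : ℂ, charmatrix (c • (1 : Matrix (Fin n) (Fin n) ℂ)) =
      (Polynomial.X - Polynomial.C c) • 1 := fun c => by
    ext i j
    by_cases hij : i = j <;> simp [hij, one_apply]
  rw [hermitianM, charpoly_reindex, charpoly, charmatrix_fromBlocks, ← neg_smul, hchar, hchar,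
    det_fromBlocks_smul_one (Polynomial.X_sub_C_ne_zero _), ← det_smul_one_sub_map_C]
  simp only [neg_mul_neg, ← Matrix.map_mul]
  congr 3
  simp only [map_neg, map_pow]
  ring

theorem eig_hermitianM (A : Plane → Matrix (Fin n) (Fin n) ℂ) (η : Space) :
    eig (hermitianM_isHermitian A η) =
      signedAppend fun j => √(η.2 ^ 2 + singVal (A η.1) j ^ 2) := by
  refine eig_eq_of_charpoly_eq_prod _ (antitone_signedAppend (fun i j hij => ?_)
    fun j => Real.sqrt_nonneg _) ?_
  · gcongr
    exacts [singVal_nonneg _ _, singVal_antitone _ hij]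
  rw [charpoly_hermitianM, charpoly_eq_prod_eig (isHermitian_conjTranspose_mul_self _),
    Polynomial.prod_comp, prod_X_sub_C_signedAppend]
  refine Finset.prod_congr rfl fun j _ => ?_
  have hsq : ((√(η.2 ^ 2 + singVal (A η.1) j ^ 2) : ℝ) : ℂ) ^ 2 =
      (η.2 : ℂ) ^ 2 + ((singVal (A η.1) j ^ 2 : ℝ) : ℂ) := by
    rw [← Complex.ofReal_pow, Real.sq_sqrt (by positivity)]
    push_cast
    rfl
  simp only [Polynomial.sub_comp, Polynomial.X_comp, Polynomial.C_comp, hsq,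
    eig_conjTranspose_mul_self, map_add, sub_sub]

theorem coalesceOnlyAt_hermitianM {Ω : Set Plane} {A : Plane → Matrix (Fin n) (Fin n) ℂ}
    (hσ : ∀ ξ ∈ Ω, Function.Injective (singVal (A ξ))) {ξ₀ : Plane}
    (hrank : ∀ ξ ∈ Ω, (A ξ).rank < n ↔ ξ = ξ₀) :
    CoalesceOnlyAt (Ω ×ˢ (Set.univ : Set ℝ)) (hermitianM A)
      (fun η _ => hermitianM_isHermitian A η) (n - 1) (ξ₀, 0) := by
  rintro j hj ⟨ξ, ε⟩ ⟨hξ, -⟩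
  have hf : StrictAnti fun j => √(ε ^ 2 + singVal (A ξ) j ^ 2) := fun i k hik => by
    have := (singVal_antitone (A ξ)).strictAnti_of_injective (hσ ξ hξ) hik
    have := singVal_nonneg (A ξ) k
    dsimp only
    gcongr
  rw [eig_hermitianM, signedAppend_eq_succ_iff hf]
  have hroot : ∀ s : ℝ, √(ε ^ 2 + s ^ 2) = 0 ↔ s = 0 ∧ ε = 0 := fun s => by
    rw [Real.sqrt_eq_zero (by positivity), add_eq_zero_iff_of_nonneg (sq_nonneg _) (sq_nonneg _),
      sq_eq_zero_iff, sq_eq_zero_iff, and_comm]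
  simp only [hroot, singVal_eq_zero_iff, Prod.mk.injEq, ← hrank ξ hξ]
  constructor
  · rintro ⟨rfl, hr, hε⟩
    exact ⟨rfl, Nat.lt_succ_of_le hr, hε⟩
  · rintro ⟨rfl, hr, hε⟩
    exact ⟨by omega, Nat.le_sub_one_of_lt hr, hε⟩

theorem eig_hermitianM_middle {A : Plane → Matrix (Fin n) (Fin n) ℂ} {ξ : Plane}
    (hr : (A ξ).rank < n) (h : n - 1 < n + n) :
    eig (hermitianM_isHermitian A (ξ, 0)) ⟨n - 1, h⟩ = 0 := by
  have hn : n - 1 < n := by omega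
  rw [eig_hermitianM, signedAppend_of_lt _ hn, singVal_eq_zero_iff.2 (Nat.le_sub_one_of_lt hr)]
  simp

end SpectrumOfM

section Compression

variable {n : ℕ}

/-- The `2n × 2` matrix with columns `(u, 0)` and `(0, v)`. For unit vectors `u`, `v` with
`A* u = 0` and `A v = 0` it is an orthonormal frame of the kernel of `[[0, A], [A*, 0]]`. -/
noncomputable def kernelFrame (u v : Fin n → ℂ) : Matrix (Fin (n + n)) (Unit ⊕ Unit) ℂ :=
  (fromBlocks (replicateCol Unit u) 0 0 (replicateCol Unit v)).submatrix finSumFinEquiv.symm id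

theorem conjTranspose_kernelFrame_mul_self {u v : Fin n → ℂ} (hu : star u ⬝ᵥ u = 1)
    (hv : star v ⬝ᵥ v = 1) : (kernelFrame u v)ᴴ * kernelFrame u v = 1 := by
  rw [kernelFrame, conjTranspose_submatrix, submatrix_mul_equiv, fromBlocks_conjTranspose,
    fromBlocks_multiply]
  ext (i | i) (j | j) <;> simp [hu, hv]

theorem hermitianM_mul_kernelFrame (A : Plane → Matrix (Fin n) (Fin n) ℂ) (η : Space)
    (u v : Fin n → ℂ) : hermitianM A η * kernelFrame u v =
      (fromBlocks ((η.2 : ℂ) • replicateCol Unit u) (replicateCol Unit (A η.1 *ᵥ v))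
        (replicateCol Unit ((A η.1)ᴴ *ᵥ u)) (-((η.2 : ℂ) • replicateCol Unit v))).submatrix
          finSumFinEquiv.symm id := by
  rw [hermitianM, reindex_apply, kernelFrame, submatrix_mul_equiv, fromBlocks_multiply]
  simp [replicateCol_mulVec]

theorem hermitianM_mul_kernelFrame_eq_smul {A : Plane → Matrix (Fin n) (Fin n) ℂ} {ξ : Plane}
    (hr : (A ξ).rank < n) {u v : Fin n → ℂ} (hu : (A ξ)ᴴ *ᵥ u = 0) (hv : A ξ *ᵥ v = 0)
    (h : n - 1 < n + n) : hermitianM A (ξ, 0) * kernelFrame u v =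
      (eig (hermitianM_isHermitian A (ξ, 0)) ⟨n - 1, h⟩ : ℂ) • kernelFrame u v := by
  rw [eig_hermitianM_middle hr]
  simp [hermitianM_mul_kernelFrame, hu, hv]

theorem kernelFrame_compression (A : Plane → Matrix (Fin n) (Fin n) ℂ) (η : Space)
    {u v : Fin n → ℂ} (hu : star u ⬝ᵥ u = 1) (hv : star v ⬝ᵥ v = 1) :
    (kernelFrame u v)ᴴ * hermitianM A η * kernelFrame u v =
      fromBlocks (of fun _ _ => (η.2 : ℂ)) (of fun _ _ => star u ⬝ᵥ (A η.1 *ᵥ v))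
        (of fun _ _ => star (star u ⬝ᵥ (A η.1 *ᵥ v))) (of fun _ _ => -(η.2 : ℂ)) := by
  have hadj : star v ⬝ᵥ ((A η.1)ᴴ *ᵥ u) = star (star u ⬝ᵥ (A η.1 *ᵥ v)) := by
    rw [star_dotProduct, star_mulVec, conjTranspose_conjTranspose, ← dotProduct_mulVec]
  rw [Matrix.mul_assoc, hermitianM_mul_kernelFrame, kernelFrame, conjTranspose_submatrix,
    submatrix_mul_equiv, fromBlocks_conjTranspose, fromBlocks_multiply, ← hadj]
  ext (i | i) (j | j) <;> simp [hu, hv]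

theorem kernelFrame_compression_eq_smul_one_iff (A : Plane → Matrix (Fin n) (Fin n) ℂ) (η : Space)
    {u v : Fin n → ℂ} (hu : star u ⬝ᵥ u = 1) (hv : star v ⬝ᵥ v = 1) :
    (∃ c : ℂ, (kernelFrame u v)ᴴ * hermitianM A η * kernelFrame u v = c • 1) ↔
      star u ⬝ᵥ (A η.1 *ᵥ v) = 0 ∧ η.2 = 0 := by
  rw [kernelFrame_compression A η hu hv]
  constructor
  · rintro ⟨c, hc⟩
    have h11 : (η.2 : ℂ) = c := by simpa using congrFun₂ hc (Sum.inl ()) (Sum.inl ())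
    have h22 : -(η.2 : ℂ) = c := by simpa using congrFun₂ hc (Sum.inr ()) (Sum.inr ())
    exact ⟨by simpa using congrFun₂ hc (Sum.inl ()) (Sum.inr ()),
      Complex.ofReal_eq_zero.1 (self_eq_neg.1 (h11.trans h22.symm))⟩
  · rintro ⟨h12, hε⟩
    refine ⟨0, ?_⟩
    ext (i | i) (j | j) <;> simp [h12, hε]

end Compression

section Derivative

variable {n : ℕ} {A : Plane → Matrix (Fin n) (Fin n) ℂ}

theorem MatrixC1On.hermitianM {Ω : Set Plane} (hA : MatrixC1On Ω A) :
    MatrixC1On (Ω ×ˢ (Set.univ : Set ℝ)) (hermitianM A) := by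
  have hε : ContDiff ℝ 1 fun η : Space => (η.2 : ℂ) := Complex.ofRealCLM.contDiff.comp contDiff_snd
  have hAfst : ∀ i j, ContDiffOn ℝ 1 (fun η : Space => A η.1 i j) (Ω ×ˢ Set.univ) := fun i j =>
    (hA i j).comp contDiff_fst.contDiffOn fun η hη => hη.1
  intro i j
  simp only [_root_.hermitianM, reindex_apply, submatrix_apply]
  rcases finSumFinEquiv.symm i with a | a <;> rcases finSumFinEquiv.symm j with b | b
  · exact (hε.mul contDiff_const).contDiffOn
  · exact hAfst a b
  · exact Complex.conjCLE.contDiff.comp_contDiffOn (hAfst b a)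
  · exact (hε.mul contDiff_const).neg.contDiffOn

-- `M` is real linear in `(A, ε)`, so its derivative is `M` formed from the derivative of `A`.
theorem matrixFDeriv_hermitianM {η : Space} (hA : MatrixC1At A η.1) (w : Space) :
    matrixFDeriv (hermitianM A) η w = hermitianM (matrixFDeriv A η.1) w := by
  have hε : HasFDerivAt (fun y : Space => (y.2 : ℂ)) _ η :=
    Complex.ofRealCLM.hasFDerivAt.comp η hasFDerivAt_snd
  have hAfst : ∀ i j, HasFDerivAt (fun y : Space => A y.1 i j) _ η := fun i j =>
    (hA.differentiableAt i j).hasFDerivAt.comp η hasFDerivAt_fst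
  ext i j
  simp only [matrixFDeriv, hermitianM, of_apply, reindex_apply, submatrix_apply]
  rcases finSumFinEquiv.symm i with a | a <;> rcases finSumFinEquiv.symm j with b | b
  · refine (congrArg (· w) (hε.mul_const ((1 : Matrix (Fin n) (Fin n) ℂ) a b)).fderiv).trans ?_
    simp [mul_comm]
  · exact congrArg (· w) (hAfst a b).fderiv
  · exact congrArg (· w)
      (Complex.conjCLE.toContinuousLinearMap.hasFDerivAt.comp η (hAfst b a)).fderiv
  · refine (congrArg (· w) (hε.mul_const ((1 : Matrix (Fin n) (Fin n) ℂ) a b)).neg.fderiv).trans ?_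
    simp [mul_comm]

end Derivative

theorem theorem3p2 {n : ℕ} (hn : 2 ≤ n) (Ω : Set Plane) (hΩ : IsOpen Ω)
    (A : Plane → Matrix (Fin n) (Fin n) ℂ) (hA : MatrixC1On Ω A)
    (hσ : ∀ ξ ∈ Ω, Function.Injective (singVal (A ξ)))
    (ξ₀ : Plane) (hξ₀ : ξ₀ ∈ Ω) (hrank : ∀ ξ ∈ Ω, (A ξ).rank < n ↔ ξ = ξ₀) :
    IsGenericLossOfRank A ξ₀ ↔
      IsGenericCoalescence (Ω ×ˢ (Set.univ : Set ℝ)) (hermitianM A)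
        (fun η _ => hermitianM_isHermitian A η) (ξ₀, 0) := by
  have hA₀ : MatrixC1At A ξ₀ := hA.matrixC1At (hΩ.mem_nhds hξ₀)
  have hr : (A ξ₀).rank < n := (hrank ξ₀ hξ₀).2 rfl
  have hadj := adjugate_ne_zero_of_singVal_injective (hσ ξ₀ hξ₀) hr
  have hrank₀ := (rank_add_one_eq (hσ ξ₀ hξ₀) hr).trans (Fintype.card_fin n).symm
  obtain ⟨v, hv, hAv, hker⟩ := exists_unit_kernel_generator hrank₀
  have hdet : (A ξ₀).det = 0 := exists_mulVec_eq_zero_iff.1 ⟨v, by rintro rfl; simp at hv, hAv⟩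
  obtain ⟨u, hu, hAu⟩ := exists_unit_cokernel hdet
  rw [isGenericLossOfRank_iff hA₀ hdet,
    (coalesceOnlyAt_hermitianM hσ hrank).isGenericCoalescence_iff ⟨hξ₀, trivial⟩
    (hΩ.prod isOpen_univ) hA.hermitianM (by omega) (by omega) rfl
    (conjTranspose_kernelFrame_mul_self hu hv) (hermitianM_mul_kernelFrame_eq_smul hr hAu hAv _)]
  simp only [hA₀.fderiv_det_eq_zero_iff hdet hadj hu hAu hker,
    matrixFDeriv_hermitianM (η := (ξ₀, 0)) hA₀, kernelFrame_compression_eq_smul_one_iff _ _ hu hv]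
  refine ⟨fun h w hw => Prod.ext (h w.1 hw.1) hw.2, fun h w hw => ?_⟩
  exact congrArg Prod.fst (h (w, 0) ⟨hw, rfl⟩)
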